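/- Let $d\ge 1$ and let $\mathcal B=\{z\in\mathbb C^d:\|z\|<1\}$. For a domain $\Omega\subset\mathbb C^d$ and $p\in\Omega$ let $s_\Omega(p)$ be the squeezing function, that is, the supremum of all $r>0$ for which there is an injective holomorphic map $f:\Omega\to\mathcal B$ with $f(p)=0$ and $r\mathcal B\subset f(\Omega)$. Let $\mathbb X_d$ be the set of convex domains (nonempty open convex sets) in $\mathbb C^d$ which contain no complex affine line, and let $\mathbb X_{d,0}$ be the set of pairs $(\Omega,x)$ with $\Omega\in\mathbb X_d$ and $x\in\Omega$. A sequence $(\Omega_n,x_n)$ converges to $(\Omega,x)$ in $\mathbb X_{d,0}$ if $x_n\to x$ and there is some $R_0\ge 0$ such that for every $R\ge R_0$ the Hausdorff distance between $\overline{\Omega_n}\cap \overline{B_R(0)}$ and $\overline{\Omega}\cap \overline{B_R(0)}$ tends to $0$, where $\overline{B_R(0)}$ is the closed Euclidean ball (the Hausdorff distance is $0$ between two empty sets and $\infty$ between an empty and a nonempty set). Give $\mathbb X_{d,0}$ the topology determined by these convergent sequences: a set is open if and only if every sequence converging to one of its points is eventually in it. **Proposition 7.1 (upper semicontinuity of the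 squeezing function).** If $(\Omega_n,x_n)$ converges to $(\Omega,x)$ in $\mathbb X_{d,0}$, then $$\limsup_{n\to\infty} s_{\Omega_n}(x_n)\le s_\Omega(x).$$ Consequently the function $(\Omega,x)\mapsto s_\Omega(x)$ is upper semicontinuous on $\mathbb X_{d,0}$. -/

import Mathlib

open Filter Topology

noncomputable section

/-- The complex Euclidean space of dimension `d`, with its Hermitian norm. -/
abbrev CSpace (d : ℕ) : Type := EuclideanSpace ℂ (Fin d)

/-- The set of `r > 0` for which there is an injective holomorphic map from `Ω` to the open unit
ball that sends `p` to `0` and whose image contains the open ball of radius `r` about `0`. -/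
def squeezingSet {d : ℕ} (Ω : Set (CSpace d)) (p : CSpace d) : Set ℝ :=
  {r : ℝ | 0 < r ∧ ∃ f : CSpace d → CSpace d,
    DifferentiableOn ℂ f Ω ∧ Set.InjOn f Ω ∧ Set.MapsTo f Ω (Metric.ball 0 1) ∧
      f p = 0 ∧ Metric.ball 0 r ⊆ f '' Ω}

/-- The squeezing function `s_Ω(p)`. For `0 < d` the set is bounded by `1`, so the supremum is
a true supremum. -/
def squeezing {d : ℕ} (Ω : Set (CSpace d)) (p : CSpace d) : ℝ :=
  sSup (squeezingSet Ω p)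

theorem squeezingSet_le_one {d : ℕ} (hd : 0 < d) {Ω : Set (CSpace d)} {p : CSpace d} {r : ℝ}
    (hr : r ∈ squeezingSet Ω p) : r ≤ 1 := by
  obtain ⟨h0, f, -, -, hmaps, -, hball⟩ := hr
  by_contra! h
  have hmem : (EuclideanSpace.single (⟨0, hd⟩ : Fin d) (1 : ℂ)) ∈ Metric.ball (0 : CSpace d) r := by
    simpa using h
  obtain ⟨z, hz, hfz⟩ := hball hmem
  have := hmaps hz
  rw [hfz] at this
  simp at this

theorem squeezing_nonneg {d : ℕ} (Ω : Set (CSpace d)) (p : CSpace d) : 0 ≤ squeezing Ω p :=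
  Real.sSup_nonneg fun _ hr => hr.1.le

theorem squeezing_le_one {d : ℕ} (hd : 0 < d) (Ω : Set (CSpace d)) (p : CSpace d) :
    squeezing Ω p ≤ 1 :=
  Real.sSup_le (fun _ hr => squeezingSet_le_one hd hr) zero_le_one

/-- The set `X_d` of convex domains in complex Euclidean space that contain no complex affine
line. -/
structure ConvexDomain (d : ℕ) where
  carrier : Set (CSpace d)
  isOpen : IsOpen carrier
  nonempty : carrier.Nonempty
  convex : Convex ℝ carrier
  no_complex_line : ¬ ∃ a v : CSpace d, v ≠ 0 ∧ ∀ z : ℂ, a + z • v ∈ carrier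

/-- The set `X_{d,0}` of pairs `(Ω, x)` with `Ω` in `X_d` and `x ∈ Ω`. -/
structure PointedConvexDomain (d : ℕ) where
  domain : ConvexDomain d
  point : CSpace d
  point_mem : point ∈ domain.carrier

/-- The local Hausdorff distance: the Hausdorff distance of the truncations to the closed ball of
radius `R` about `0`. It takes values in `[0, ∞]`; it is `∞` exactly if just one of the two
truncations is empty. -/
def localHausdorffEDist {d : ℕ} (R : ℝ) (A B : Set (CSpace d)) : ENNReal :=
  Metric.hausdorffEDist (A ∩ Metric.closedBall 0 R) (B ∩ Metric.closedBall 0 R)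

/-- Convergence of a sequence of open convex sets in the local Hausdorff topology. -/
def LocalHausdorffConverges {d : ℕ} (A : ℕ → Set (CSpace d)) (B : Set (CSpace d)) : Prop :=
  ∃ R₀ : ℝ, 0 ≤ R₀ ∧ ∀ R : ℝ, R₀ ≤ R →
    Tendsto (fun n => localHausdorffEDist R (closure (A n)) (closure B)) atTop (𝓝 0)

/-- Convergence of a sequence `(Ω_n, x_n)` to `(Ω, x)` in `X_{d,0}`. -/
def PointedConvexDomain.Converges {d : ℕ} (P : ℕ → PointedConvexDomain d)
    (Q : PointedConvexDomain d) : Prop :=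
  LocalHausdorffConverges (fun n => (P n).domain.carrier) Q.domain.carrier ∧
    Tendsto (fun n => (P n).point) atTop (𝓝 Q.point)

/-- The topology of `X_{d,0}`, determined by its convergent sequences: a set is open if every
sequence that converges to one of its points is eventually in it. -/
instance PointedConvexDomain.instTopologicalSpace (d : ℕ) :
    TopologicalSpace (PointedConvexDomain d) where
  IsOpen U := ∀ Q ∈ U, ∀ P : ℕ → PointedConvexDomain d,
    PointedConvexDomain.Converges P Q → ∀ᶠ n in atTop, P n ∈ U
  isOpen_univ := fun _ _ _ _ => Eventually.of_forall fun _ => Set.mem_univ _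
  isOpen_inter := fun _ _ hs ht Q hQ P hP => (hs Q hQ.1 P hP).and (ht Q hQ.2 P hP)
  isOpen_sUnion := fun _ hS Q hQ P hP => by
    obtain ⟨s, hs, hQs⟩ := hQ
    exact (hS s hs Q hQs P hP).mono fun _ hn => ⟨s, hs, hn⟩

/-- The squeezing function as a function on `X_{d,0}`. -/
def PointedConvexDomain.squeezing {d : ℕ} (P : PointedConvexDomain d) : ℝ :=
  _root_.squeezing P.domain.carrier P.point

end

/-! Suppose L lies strictly between s_Ω(x) and the limsup. For infinitely many n there is an
embedding f_n of Ω_n into the unit ball whose image contains the ball of radius L; let g_n be its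
inverse on that ball. If F = lim f_n and G = lim g_n exist with F ∘ G = id, and F is an embedding of
Ω, then F realizes L for (Ω, x), a contradiction (`PointedConvexDomain.Converges.mem_squeezingSet`).
Limits are pointwise along an ultrafilter on these n. A second order Schwarz estimate with uniform
constants makes such limits of bounded families holomorphic.

The f_n are bounded by 1, but the g_n take values in possibly unbounded sets; here convexity and the
absence of complex lines enter. By compactness, an affine disc in Ω_n has radius at most M(1 +
distance of its centre from x_n) for large n, since otherwise rescaled discs would converge to a
line in the closure of Ω (`exists_affine_disc_bound`). A Koebe type estimate turns derivatives of
g_n into such discs, so the derivative of g_n grows at most linearly in g_n - x_n, and Gronwall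
bounds g_n on smaller balls.

The maximum principle keeps F in the open unit ball and G in Ω. From F ∘ G = id the derivative of F
at x is invertible, and Hurwitz, applied to the Jacobian determinant on complex lines, makes F
injective (`NormalAlong.injOn_limit`). This step and the holomorphy of g_n both rest on Osgood's
theorem that injective holomorphic maps in equal dimensions have invertible derivatives, proved by
induction on the dimension. -/

theorem exists_ball_bounded {E F : Type*} [NormedAddCommGroup E] [NormedAddCommGroup F]
    {f : E → F} {U : Set E} (hU : IsOpen U) (hf : ContinuousOn f U)
    {c : E} (hc : c ∈ U) :
    ∃ ρ > 0, Metric.ball c ρ ⊆ U ∧ ∃ M, ∀ w ∈ Metric.ball c ρ, ‖f w‖ ≤ M := by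
  have h1 : ∀ᶠ z in 𝓝 c, ‖f z‖ < ‖f c‖ + 1 :=
    (hf.continuousAt (hU.mem_nhds hc)).norm.eventually_lt_const (lt_add_one _)
  obtain ⟨ρ, hρ, h⟩ := Metric.mem_nhds_iff.1 (h1.and (hU.mem_nhds hc))
  exact ⟨ρ, hρ, fun z hz => (h hz).2, _, fun z hz => (h hz).1.le⟩

/-! ### Schwarz estimates, limits and smoothness of holomorphic maps in several variables -/

section HolomorphicLimits

variable {E F : Type*} [NormedAddCommGroup E] [NormedSpace ℂ E]
  [NormedAddCommGroup F] [NormedSpace ℂ F]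

theorem dist_le_of_differentiableOn_ball {f : E → F} {c z : E} {ρ M : ℝ}
    (hf : DifferentiableOn ℂ f (Metric.ball c ρ)) (hM : ∀ w ∈ Metric.ball c ρ, ‖f w‖ ≤ M)
    (hz : z ∈ Metric.ball c ρ) : ‖f z - f c‖ ≤ 2 * M / ρ * ‖z - c‖ := by
  have hρ : 0 < ρ := Metric.nonempty_ball.1 ⟨z, hz⟩
  have hmaps : Set.MapsTo f (Metric.ball c ρ) (Metric.closedBall (f c) (2 * M)) := by
    intro w hw
    rw [mem_closedBall_iff_norm]
    have h1 := hM w hw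
    have h2 := hM c (Metric.mem_ball_self hρ)
    linarith [norm_sub_le (f w) (f c)]
  have := Complex.dist_le_div_mul_dist_of_mapsTo_ball hf hmaps hz
  rwa [dist_eq_norm, dist_eq_norm] at this

theorem norm_fderiv_le_of_differentiableOn_ball {f : E → F} {c : E} {ρ M : ℝ} (hρ : 0 < ρ)
    (hf : DifferentiableOn ℂ f (Metric.ball c ρ)) (hM : ∀ w ∈ Metric.ball c ρ, ‖f w‖ ≤ M) :
    ‖fderiv ℂ f c‖ ≤ 2 * M / ρ := by
  have hmaps : Set.MapsTo f (Metric.ball c ρ) (Metric.closedBall (f c) (2 * M)) := by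
    intro w hw
    rw [mem_closedBall_iff_norm]
    have h1 := hM w hw
    have h2 := hM c (Metric.mem_ball_self hρ)
    linarith [norm_sub_le (f w) (f c)]
  exact Complex.norm_fderiv_le_div_of_mapsTo_ball hf hmaps hρ

/-- The second order Schwarz estimate for a bounded holomorphic map on a ball. -/
theorem norm_sub_sub_fderiv_le {f : E → F} {c z : E} {ρ M : ℝ}
    (hf : DifferentiableOn ℂ f (Metric.ball c ρ)) (hM : ∀ w ∈ Metric.ball c ρ, ‖f w‖ ≤ M)
    (hz : z ∈ Metric.ball c ρ) :
    ‖f z - f c - fderiv ℂ f c (z - c)‖ ≤ 4 * M / ρ ^ 2 * ‖z - c‖ ^ 2 := by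
  have hρ : 0 < ρ := Metric.nonempty_ball.1 ⟨z, hz⟩
  have hM0 : 0 ≤ M := (norm_nonneg _).trans (hM z hz)
  set A := fderiv ℂ f c with hA
  have hAle : ‖A‖ ≤ 2 * M / ρ := norm_fderiv_le_of_differentiableOn_ball hρ hf hM
  have hfc : HasFDerivAt f A c := (hf.differentiableAt (Metric.ball_mem_nhds _ hρ)).hasFDerivAt
  -- Removing the linear part makes h - h c vanish to second order, so the Schwarz lemma with
  -- exponent 2 applies; f and A each contribute 2M to the bound 4M.
  let h : E → F := fun w => f w - A (w - c)
  have hh : DifferentiableOn ℂ h (Metric.ball c ρ) := by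
    apply hf.sub
    exact (A.differentiable.comp (differentiable_id.sub_const c)).differentiableOn
  have hmaps : Set.MapsTo h (Metric.ball c ρ) (Metric.closedBall (h c) (4 * M)) := by
    intro w hw
    rw [mem_closedBall_iff_norm]
    have h1 := hM w hw
    have h2 := hM c (Metric.mem_ball_self hρ)
    have h3 : ‖A (w - c)‖ ≤ 2 * M := by
      refine (A.le_opNorm _).trans ?_
      have : ‖w - c‖ ≤ ρ := (mem_ball_iff_norm.1 hw).le
      calc ‖A‖ * ‖w - c‖ ≤ 2 * M / ρ * ρ := by gcongr
        _ = 2 * M := by field_simp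
    have : h w - h c = f w - f c - A (w - c) := by simp [h]; abel
    rw [this]
    linarith [norm_sub_le (f w - f c) (A (w - c)), norm_sub_le (f w) (f c)]
  have ho : (fun w => h w - h c) =o[𝓝 c] fun w => ‖w - c‖ ^ 1 := by
    have := hfc.isLittleO
    simp only [pow_one]
    refine (this.congr_left ?_).norm_right
    intro w
    simp [h]; abel
  have := Complex.dist_le_mul_div_pow_of_mapsTo_ball_of_isLittleO hh hmaps ho hz
  rw [dist_eq_norm, dist_eq_norm] at this
  have e : h z - h c = f z - f c - A (z - c) := by simp [h]; abel
  rw [e] at this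
  refine this.trans_eq ?_
  rw [one_add_one_eq_two, div_pow]
  ring

theorem hasFDerivAt_of_quadratic {f : E → F} {A : E →L[ℂ] F} {c : E} {ρ C : ℝ} (hρ : 0 < ρ)
    (h : ∀ z ∈ Metric.ball c ρ, ‖f z - f c - A (z - c)‖ ≤ C * ‖z - c‖ ^ 2) :
    HasFDerivAt f A c := by
  refine HasFDerivAt.of_isLittleO ?_
  refine (Asymptotics.IsBigO.of_bound C (g := fun z => ‖z - c‖ ^ 2) ?_).trans_isLittleO ?_
  · filter_upwards [Metric.ball_mem_nhds c hρ] with z hz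
    simpa using h z hz
  · refine Asymptotics.isLittleO_norm_right.1 ?_
    have : Tendsto (fun z => ‖z - c‖) (𝓝 c) (𝓝 0) := by
      have : Continuous fun z : E => ‖z - c‖ := by fun_prop
      simpa using this.tendsto c
    have h2 := (Asymptotics.isLittleO_pow_id (𝕜 := ℝ) (n := 2) (by norm_num)).comp_tendsto this
    simpa [Function.comp_def] using h2

variable {ι : Type*} {l : Filter ι}

/-- Holomorphic maps that are uniformly bounded on a ball and converge pointwise converge
continuously at the centre. -/
theorem tendsto_prod_nhds_of_bounded {G : ι → E → F} {f : E → F} {c : E} {ρ M : ℝ} (hρ : 0 < ρ)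
    (hG : ∀ᶠ i in l, DifferentiableOn ℂ (G i) (Metric.ball c ρ) ∧
      ∀ w ∈ Metric.ball c ρ, ‖G i w‖ ≤ M)
    (hc : Tendsto (fun i => G i c) l (𝓝 (f c))) :
    Tendsto (fun p : ι × E => G p.1 p.2) (l ×ˢ 𝓝 c) (𝓝 (f c)) := by
  have h1 : Tendsto (fun p : ι × E => G p.1 p.2 - G p.1 c) (l ×ˢ 𝓝 c) (𝓝 0) := by
    have h2 : Tendsto (fun p : ι × E => 2 * M / ρ * ‖p.2 - c‖) (l ×ˢ 𝓝 c) (𝓝 0) := by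
      have : Continuous fun z : E => 2 * M / ρ * ‖z - c‖ := by fun_prop
      have := (this.tendsto c).comp (tendsto_snd (f := l))
      simpa [Function.comp_def] using this
    refine squeeze_zero_norm' ?_ h2
    filter_upwards [hG.prod_mk (Metric.ball_mem_nhds c hρ)] with p hp
    exact dist_le_of_differentiableOn_ball hp.1.1 hp.1.2 hp.2
  have := h1.add (hc.comp (tendsto_fst (g := 𝓝 c)))
  simpa [Function.comp_def] using this

variable [FiniteDimensional ℂ E] [FiniteDimensional ℂ F]

/-- The derivatives at c lie in a compact ball of operators, so they have a limit A along u. The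
constant in the second order estimate depends only on M and ρ, so the estimate survives the limit
and exhibits A as the derivative of f. -/
theorem exists_hasFDerivAt_ultrafilter_limit {u : Ultrafilter ι} {G : ι → E → F} {f : E → F}
    {c : E} {ρ M : ℝ} (hρ : 0 < ρ)
    (hG : ∀ᶠ i in (u : Filter ι), DifferentiableOn ℂ (G i) (Metric.ball c ρ) ∧
      ∀ w ∈ Metric.ball c ρ, ‖G i w‖ ≤ M)
    (hlim : ∀ z ∈ Metric.ball c ρ, Tendsto (fun i => G i z) u (𝓝 (f z))) :
    ∃ A, HasFDerivAt f A c ∧ Tendsto (fun i => fderiv ℂ (G i) c) u (𝓝 A) := by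
  have : FiniteDimensional ℂ (E →L[ℂ] F) := inferInstance
  have : ProperSpace (E →L[ℂ] F) := FiniteDimensional.proper ℂ _
  have hK : IsCompact (Metric.closedBall (0 : E →L[ℂ] F) (2 * M / ρ)) := isCompact_closedBall _ _
  obtain ⟨A, -, hA⟩ := hK.ultrafilter_le_nhds' (u.map fun i => fderiv ℂ (G i) c) (by
    have : ∀ᶠ i in (u : Filter ι), fderiv ℂ (G i) c ∈ Metric.closedBall 0 (2 * M / ρ) := by
      filter_upwards [hG] with i hi
      simpa using norm_fderiv_le_of_differentiableOn_ball hρ hi.1 hi.2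
    exact this)
  have hA' : Tendsto (fun i => fderiv ℂ (G i) c) u (𝓝 A) := hA
  refine ⟨A, hasFDerivAt_of_quadratic (C := 4 * M / ρ ^ 2) hρ ?_, hA'⟩
  intro z hz
  have h1 : Tendsto (fun i => ‖G i z - G i c - fderiv ℂ (G i) c (z - c)‖) u
      (𝓝 ‖f z - f c - A (z - c)‖) :=
    (((hlim z hz).sub (hlim c (Metric.mem_ball_self hρ))).sub
      ((ContinuousLinearMap.apply ℂ F (z - c)).continuous.tendsto A |>.comp hA')).norm
  refine le_of_tendsto h1 ?_
  filter_upwards [hG] with i hi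
  exact norm_sub_sub_fderiv_le hi.1 hi.2 hz

/-- A bounded pointwise limit of holomorphic maps is holomorphic, and the derivatives converge. -/
theorem hasFDerivAt_limit [l.NeBot] {G : ι → E → F} {f : E → F} {c : E} {ρ M : ℝ} (hρ : 0 < ρ)
    (hG : ∀ᶠ i in l, DifferentiableOn ℂ (G i) (Metric.ball c ρ) ∧
      ∀ w ∈ Metric.ball c ρ, ‖G i w‖ ≤ M)
    (hlim : ∀ z ∈ Metric.ball c ρ, Tendsto (fun i => G i z) l (𝓝 (f z))) :
    DifferentiableAt ℂ f c ∧ Tendsto (fun i => fderiv ℂ (G i) c) l (𝓝 (fderiv ℂ f c)) := by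
  have key : ∀ u : Ultrafilter ι, (u : Filter ι) ≤ l →
      ∃ A, HasFDerivAt f A c ∧ Tendsto (fun i => fderiv ℂ (G i) c) u (𝓝 A) := fun u hu =>
    exists_hasFDerivAt_ultrafilter_limit hρ (hu hG) fun z hz => (hlim z hz).mono_left hu
  constructor
  · obtain ⟨A, hA, -⟩ := key (Ultrafilter.of l) (Ultrafilter.of_le l)
    exact hA.differentiableAt
  -- Every ultrafilter limit of the derivatives is the derivative of the same f, so all of them
  -- agree.
  · rw [tendsto_iff_ultrafilter]
    intro u hu
    obtain ⟨A, hA, hA'⟩ := key u hu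
    rwa [hA.fderiv]

/-- A directional derivative is the pointwise limit of difference quotients, which are holomorphic
and, by the Schwarz lemma, locally bounded uniformly in the increment s. -/
theorem DifferentiableOn.fderiv_apply_of_isOpen {f : E → F} {U : Set E} (hU : IsOpen U)
    (hf : DifferentiableOn ℂ f U) (v : E) :
    DifferentiableOn ℂ (fun z => fderiv ℂ f z v) U := by
  intro c hc
  apply DifferentiableAt.differentiableWithinAt
  obtain ⟨ρ, hρ, hsub, M, hM⟩ := exists_ball_bounded hU hf.continuousOn hc
  have hfb := hf.mono hsub
  have hball : ∀ z ∈ Metric.ball c (ρ / 2), Metric.ball z (ρ / 2) ⊆ Metric.ball c ρ := by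
    intro z hz w hw
    rw [Metric.mem_ball] at *
    linarith [dist_triangle w z c]
  let G : ℂ → E → F := fun s z => s⁻¹ • (f (z + s • v) - f z)
  have hsmall : ∀ᶠ s : ℂ in 𝓝[≠] 0, ‖s • v‖ < ρ / 2 := by
    apply nhdsWithin_le_nhds
    have : Continuous fun s : ℂ => ‖s • v‖ := by fun_prop
    exact (this.tendsto 0).eventually_lt_const (by simpa using by positivity)
  refine (hasFDerivAt_limit (l := 𝓝[≠] (0 : ℂ)) (G := G) (ρ := ρ / 2)
    (M := 2 * M / (ρ / 2) * ‖v‖) (by positivity) ?_ ?_).1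
  · filter_upwards [hsmall, self_mem_nhdsWithin] with s hs hs0
    have hmem : ∀ z ∈ Metric.ball c (ρ / 2), z + s • v ∈ Metric.ball z (ρ / 2) := by
      intro z hz; simpa [mem_ball_iff_norm] using hs
    constructor
    · apply DifferentiableOn.const_smul
      refine DifferentiableOn.sub (hfb.comp (by fun_prop) fun z hz => hball z hz (hmem z hz))
        (hfb.mono (Metric.ball_subset_ball (by linarith)))
    · intro z hz
      have := dist_le_of_differentiableOn_ball (hfb.mono (hball z hz))
        (fun w hw => hM w (hball z hz hw)) (hmem z hz)
      simp only [add_sub_cancel_left, norm_smul] at this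
      have hs0' : 0 < ‖s‖ := norm_pos_iff.2 hs0
      simp only [G, norm_smul, norm_inv]
      rw [inv_mul_le_iff₀ hs0']
      linarith
  · intro z hz
    have hz' : DifferentiableAt ℂ f z :=
      hfb.differentiableAt (Metric.isOpen_ball.mem_nhds
        (Metric.ball_subset_ball (by linarith) hz))
    have h1 : HasDerivAt (fun s : ℂ => f (z + s • v)) (fderiv ℂ f z v) 0 :=
      (hz'.hasFDerivAt.hasLineDerivAt v)
    have := h1.tendsto_slope
    refine this.congr fun s => ?_
    simp [slope_def_module, G]

theorem DifferentiableOn.contDiffOn_nat {U : Set E} (hU : IsOpen U) (n : ℕ) :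
    ∀ {f : E → F}, DifferentiableOn ℂ f U → ContDiffOn ℂ n f U := by
  induction n with
  | zero => intro f hf; simpa using hf.continuousOn
  | succ n ih =>
    intro f hf
    push_cast
    rw [contDiffOn_succ_iff_fderiv_of_isOpen hU]
    refine ⟨hf, by simp, ?_⟩
    rw [contDiffOn_clm_apply]
    exact fun v => ih (hf.fderiv_apply_of_isOpen hU v)

theorem DifferentiableOn.differentiableOn_fderiv {U : Set E} (hU : IsOpen U) {f : E → F}
    (hf : DifferentiableOn ℂ f U) : DifferentiableOn ℂ (fderiv ℂ f) U :=
  ((contDiffOn_succ_iff_fderiv_of_isOpen (n := 1) hU).1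
    (hf.contDiffOn_nat hU 2)).2.2.differentiableOn (by simp)

theorem DifferentiableOn.contDiffAt_one {U : Set E} (hU : IsOpen U) {f : E → F}
    (hf : DifferentiableOn ℂ f U) {z : E} (hz : z ∈ U) : ContDiffAt ℂ 1 f z :=
  (by simpa using hf.contDiffOn_nat hU 1 : ContDiffOn ℂ 1 f U).contDiffAt (hU.mem_nhds hz)

theorem DifferentiableOn.hasStrictFDerivAt {U : Set E} (hU : IsOpen U) {f : E → F}
    (hf : DifferentiableOn ℂ f U) {z : E} (hz : z ∈ U) :
    HasStrictFDerivAt f (fderiv ℂ f z) z :=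
  (hf.contDiffAt_one hU hz).hasStrictFDerivAt (by simp)

end HolomorphicLimits

/-! ### Hurwitz's theorem in one variable -/

section Hurwitz

/-- Minimum modulus principle: a function that is smaller at the centre than on the bounding
circle has a zero in the disc. -/
theorem exists_zero_of_norm_lt {φ : ℂ → ℂ} {r m : ℝ} (hr : 0 < r)
    (hφ : DiffContOnCl ℂ φ (Metric.ball 0 r)) (h0 : ‖φ 0‖ < m)
    (hm : ∀ s ∈ Metric.sphere (0 : ℂ) r, m < ‖φ s‖) :
    ∃ s ∈ Metric.closedBall (0 : ℂ) r, φ s = 0 := by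
  by_contra! hne
  have hm0 : 0 < m := (norm_nonneg _).trans_lt h0
  have hcl : closure (Metric.ball (0 : ℂ) r) = Metric.closedBall 0 r := closure_ball _ hr.ne'
  have hinv : DiffContOnCl ℂ φ⁻¹ (Metric.ball 0 r) :=
    hφ.inv fun s hs => hne s (hcl ▸ hs)
  have := Complex.norm_le_of_forall_mem_frontier_norm_le (C := m⁻¹) Metric.isBounded_ball hinv
    (by
      intro s hs
      rw [frontier_ball _ hr.ne'] at hs
      rw [Pi.inv_apply, norm_inv]
      exact inv_anti₀ hm0 (hm s hs).le) (z := 0) (by rw [hcl]; simp [hr.le])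
  rw [Pi.inv_apply, norm_inv] at this
  have h1 : 0 < ‖φ 0‖ := norm_pos_iff.2 (hne 0 (by simp [hr.le]))
  exact absurd ((inv_le_inv₀ h1 hm0).1 this) (not_le.2 h0)

/-- A form of the theorem of Hurwitz for a family indexed by a filter. -/
theorem eventually_exists_zero {ι : Type*} {l : Filter ι} {Φ : ι → ℂ → ℂ} {φ : ℂ → ℂ} {r : ℝ}
    (hr : 0 < r) (hΦ : ∀ᶠ i in l, DiffContOnCl ℂ (Φ i) (Metric.ball 0 r))
    (hφ : ContinuousOn φ (Metric.sphere 0 r))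
    (hlim : ∀ s ∈ Metric.sphere (0 : ℂ) r,
      Tendsto (fun p : ι × ℂ => Φ p.1 p.2) (l ×ˢ 𝓝 s) (𝓝 (φ s)))
    (h0 : Tendsto (fun i => Φ i 0) l (𝓝 0)) (hne : ∀ s ∈ Metric.sphere (0 : ℂ) r, φ s ≠ 0) :
    ∀ᶠ i in l, ∃ s ∈ Metric.closedBall (0 : ℂ) r, Φ i s = 0 := by
  have hK : IsCompact (Metric.sphere (0 : ℂ) r) := isCompact_sphere _ _
  have hKne : (Metric.sphere (0 : ℂ) r).Nonempty := ⟨(r : ℂ), by simp [abs_of_pos hr]⟩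
  obtain ⟨s₀, hs₀, hmin⟩ := hK.exists_isMinOn hKne hφ.norm
  set m := ‖φ s₀‖ / 2 with hm
  have hpos : 0 < ‖φ s₀‖ := norm_pos_iff.2 (hne s₀ hs₀)
  have hev : ∀ᶠ i in l, ∀ s ∈ Metric.sphere (0 : ℂ) r, m < ‖Φ i s‖ := by
    -- Joint convergence gives the lower bound near each point of the circle; compactness patches
    -- these bounds together.
    refine hK.induction_on (p := fun S => ∀ᶠ i in l, ∀ s ∈ S, m < ‖Φ i s‖) (by simp)
      (fun S T hST hT => hT.mono fun i hi s hs => hi s (hST hs))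
      (fun S T hS hT => (hS.and hT).mono fun i hi s hs => hs.elim (hi.1 s) (hi.2 s)) ?_
    intro s hs
    have h1 : m < ‖φ s‖ := by
      have : ‖φ s₀‖ ≤ ‖φ s‖ := hmin hs
      linarith
    obtain ⟨p, hp, q, hq, hpq⟩ := eventually_prod_iff.1 ((hlim s hs).norm.eventually_const_lt h1)
    exact ⟨{y | q y}, mem_nhdsWithin_of_mem_nhds hq, hp.mono fun i hi y hy => hpq hi hy⟩
  have h0' : ∀ᶠ i in l, ‖Φ i 0‖ < m := by
    have := h0.norm
    rw [norm_zero] at this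
    exact this.eventually_lt_const (by positivity)
  filter_upwards [hΦ, hev, h0'] with i h1 h2 h3
  exact exists_zero_of_norm_lt hr h1 h3 h2

end Hurwitz

/-! ### Critical points of injective holomorphic maps -/

section Osgood

/-- An injective holomorphic function of one variable has no critical point. -/
theorem deriv_ne_zero_of_injOn {f : ℂ → ℂ} {U : Set ℂ} (hU : IsOpen U)
    (hf : DifferentiableOn ℂ f U) (hinj : Set.InjOn f U) {z : ℂ} (hz : z ∈ U) :
    deriv f z ≠ 0 := by
  intro hz0
  have han : AnalyticOnNhd ℂ f U := hf.analyticOnNhd hU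
  have hnc : ∀ w ∈ U, ¬ ∀ᶠ y in 𝓝 w, f y = f w := by
    intro w hw h
    obtain ⟨y, hy, hyw⟩ := ((h.and (hU.mem_nhds hw)).filter_mono
      (nhdsWithin_le_nhds (s := {w}ᶜ))).and self_mem_nhdsWithin |>.exists
    exact hyw (hinj hy.2 hw hy.1)
  have hopen : ∀ w ∈ U, 𝓝 (f w) ≤ map f (𝓝 w) := fun w hw =>
    (han w hw).eventually_constant_or_nhds_le_map_nhds.resolve_left (hnc w hw)
  -- The inverse g is continuous because f is open, and differentiable near f z except possibly at f
  -- z, because critical points are isolated. The singularity is removable, and the chain rule for g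
  -- ∘ f = id then reads 0 = 1 at z.
  set g := Function.invFunOn f U with hg
  have hgf : ∀ w ∈ U, g (f w) = w := fun w hw => hinj.leftInvOn_invFunOn hw
  have hgt : ∀ w ∈ U, Tendsto g (𝓝 (f w)) (𝓝 w) := by
    intro w hw
    refine (map_mono (hopen w hw)).trans ?_
    rw [map_map]
    refine Tendsto.congr' ?_ tendsto_id
    filter_upwards [hU.mem_nhds hw] with y hy
    exact (hgf y hy).symm
  have hgc : ∀ w ∈ U, ContinuousAt g (f w) := by
    intro w hw
    rw [ContinuousAt, hgf w hw]
    exact hgt w hw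
  have hfg : ∀ w ∈ U, ∀ᶠ y in 𝓝 (f w), f (g y) = y ∧ g y ∈ U := by
    intro w hw
    refine (hopen w hw) ?_
    rw [mem_map]
    filter_upwards [hU.mem_nhds hw] with y hy
    simp only [Set.mem_preimage, Set.mem_ofPred_eq]
    rw [hgf y hy]
    exact ⟨rfl, hy⟩
  have hisol : ∀ᶠ w in 𝓝[≠] z, deriv f w ≠ 0 := by
    refine (han z hz).deriv.eventually_eq_zero_or_eventually_ne_zero.resolve_left fun h => ?_
    obtain ⟨ρ, hρ, hball⟩ := Metric.mem_nhds_iff.1 (h.and (hU.mem_nhds hz))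
    refine hnc z hz ?_
    filter_upwards [Metric.ball_mem_nhds z hρ] with y hy
    exact Metric.isOpen_ball.is_const_of_deriv_eq_zero (convex_ball z ρ).isPreconnected
      (hf.mono fun w hw => (hball hw).2) (fun w hw => (hball hw).1) hy
      (Metric.mem_ball_self hρ)
  have hdiff : ∀ᶠ y in 𝓝[≠] (f z), DifferentiableAt ℂ g y := by
    have h1 : ∀ᶠ y in 𝓝 (f z), g y ≠ z → deriv f (g y) ≠ 0 :=
      hgt z hz (eventually_nhdsWithin_iff.1 hisol)
    filter_upwards [nhdsWithin_le_nhds h1, nhdsWithin_le_nhds (hfg z hz), self_mem_nhdsWithin]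
      with y hy1 hy2 hy3
    have hne : g y ≠ z := by
      rintro h
      exact hy3 (by rw [← hy2.1, h]; rfl)
    have hcy : ContinuousAt g y := by simpa [hy2.1] using hgc (g y) hy2.2
    have hevy : ∀ᶠ x in 𝓝 y, f (g x) = x := by
      have := hfg (g y) hy2.2
      rw [hy2.1] at this
      exact this.mono fun x hx => hx.1
    exact (HasDerivAt.of_local_left_inverse hcy
      (hf.differentiableAt (hU.mem_nhds hy2.2)).hasDerivAt (hy1 hne) hevy).differentiableAt
  have hga : AnalyticAt ℂ g (f z) :=
    Complex.analyticAt_of_differentiable_on_punctured_nhds_of_continuousAt hdiff (hgc z hz)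
  have hfz : HasDerivAt f 0 z := hz0 ▸ (hf.differentiableAt (hU.mem_nhds hz)).hasDerivAt
  have hcomp : HasDerivAt (g ∘ f) (deriv g (f z) * 0) z :=
    hga.differentiableAt.hasDerivAt.comp z hfz
  have hid : HasDerivAt (g ∘ f) 1 z := by
    refine (hasDerivAt_id z).congr_of_eventuallyEq ?_
    filter_upwards [hU.mem_nhds hz] with y hy
    exact hgf y hy
  simpa using hcomp.unique hid

variable {E F : Type*} [NormedAddCommGroup E] [NormedSpace ℂ E]
  [NormedAddCommGroup F] [NormedSpace ℂ F]

/-- If `u` vanishes on the zero set of `h` and has a nonzero derivative at a zero of `h`, then a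
map whose derivative vanishes on the zero set of `h` is not injective. -/
theorem false_of_injOn_of_fderiv_eq_zero [FiniteDimensional ℂ E] {f : E → F} {h u : E → ℂ}
    {U : Set E} (hU : IsOpen U) (hf : DifferentiableOn ℂ f U) (hinj : Set.InjOn f U)
    (hh : DifferentiableOn ℂ h U) (hhf : ∀ z ∈ U, h z = 0 → fderiv ℂ f z = 0)
    (hu : DifferentiableOn ℂ u U) (huh : ∀ z ∈ U, h z = 0 → u z = 0)
    {a v w : E} (ha : a ∈ U) (hha : h a = 0) (hv : fderiv ℂ u a v ≠ 0)
    (hvw : ∀ s t : ℂ, s • v + t • w = 0 → t = 0) : False := by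
  set c := fderiv ℂ u a v with hc
  have hc0 : 0 < ‖c‖ := norm_pos_iff.2 hv
  -- the zero set lies in a cone
  obtain ⟨ε, hε, hεU, C, hC0, hcone⟩ : ∃ ε > 0, Metric.ball a ε ⊆ U ∧ ∃ C : ℝ, 0 ≤ C ∧
      ∀ p ∈ Metric.ball a ε, ∀ q ∈ Metric.ball a ε, h p = 0 → h q = 0 → ∀ s t : ℂ,
        p - q = s • v + t • w → ‖s‖ ≤ C * ‖t‖ := by
    -- Strict differentiability of u, applied to two zeros of h, bounds s • c + t • u'(w) by κ‖s • v
    -- + t • w‖. This κ is small enough for the part of the error in s to be absorbed by half of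
    -- ‖s‖‖c‖.
    set κ : ℝ := ‖c‖ / (2 * (‖v‖ + 1)) with hκ
    have hκ0 : 0 < κ := by positivity
    have hκv : κ * ‖v‖ ≤ ‖c‖ / 2 := by
      rw [hκ, div_mul_eq_mul_div, div_le_div_iff₀ (by positivity) (by positivity)]
      nlinarith [norm_nonneg v]
    obtain ⟨N, hN, happ⟩ := (hu.hasStrictFDerivAt hU ha).approximates_deriv_on_nhds
      (c := ⟨κ, hκ0.le⟩) (Or.inr hκ0)
    obtain ⟨ε, hε, hball⟩ := Metric.mem_nhds_iff.1 (inter_mem hN (hU.mem_nhds ha))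
    refine ⟨ε, hε, fun z hz => (hball hz).2, 2 / ‖c‖ * (‖fderiv ℂ u a w‖ + κ * ‖w‖),
      by positivity, ?_⟩
    intro p hp q hq hp0 hq0 s t hst
    have h1 := happ p (hball hp).1 q (hball hq).1
    rw [huh p (hball hp).2 hp0, huh q (hball hq).2 hq0, hst] at h1
    simp only [sub_self, zero_sub, norm_neg, map_add, map_smul, smul_eq_mul, ← hc] at h1
    change _ ≤ κ * _ at h1
    have h2 : ‖s • v + t • w‖ ≤ ‖s‖ * ‖v‖ + ‖t‖ * ‖w‖ := by
      simpa [norm_smul] using norm_add_le (s • v) (t • w)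
    have h3 : ‖s‖ * ‖c‖ ≤ ‖s * c + t * fderiv ℂ u a w‖ + ‖t‖ * ‖fderiv ℂ u a w‖ := by
      simpa using norm_sub_le (s * c + t * fderiv ℂ u a w) (t * fderiv ℂ u a w)
    have h4 : κ * ‖s • v + t • w‖ ≤ κ * (‖s‖ * ‖v‖ + ‖t‖ * ‖w‖) := by gcongr
    have h5 : ‖s‖ * (κ * ‖v‖) ≤ ‖s‖ * (‖c‖ / 2) := by gcongr
    have h6 : ‖s‖ * (‖c‖ / 2) ≤ ‖t‖ * (‖fderiv ℂ u a w‖ + κ * ‖w‖) := by nlinarith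
    calc ‖s‖ = 2 / ‖c‖ * (‖s‖ * (‖c‖ / 2)) := by field_simp
      _ ≤ 2 / ‖c‖ * (‖t‖ * (‖fderiv ℂ u a w‖ + κ * ‖w‖)) := by gcongr
      _ = _ := by ring
  -- a bidisc in the plane spanned by `v` and `w`
  let P : ℂ → ℂ → E := fun t s => a + s • v + t • w
  have hPc : Continuous fun p : ℂ × ℂ => P p.1 p.2 := by fun_prop
  obtain ⟨r, hr, hrP⟩ : ∃ r > 0, ∀ t s : ℂ, ‖t‖ ≤ r → ‖s‖ ≤ r → P t s ∈ Metric.ball a ε := by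
    have : ∀ᶠ p : ℂ × ℂ in 𝓝 0, P p.1 p.2 ∈ Metric.ball a ε := by
      refine hPc.continuousAt.eventually_mem (Metric.isOpen_ball.mem_nhds ?_)
      simpa [P] using hε
    obtain ⟨r, hr, hball⟩ := Metric.nhds_basis_closedBall.mem_iff.1 this
    refine ⟨r, hr, fun t s ht hs => hball (a := (t, s)) ?_⟩
    simp [Prod.norm_def, ht, hs]
  have hhP : ∀ t s : ℂ, ‖t‖ ≤ r → ‖s‖ ≤ r → ContinuousAt (fun p : ℂ × ℂ => h (P p.1 p.2)) (t, s) := by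
    intro t s ht hs
    refine ContinuousAt.comp (f := fun p : ℂ × ℂ => P p.1 p.2) (g := h) ?_ hPc.continuousAt
    exact (hh.differentiableAt (hU.mem_nhds (hεU (hrP t s ht hs)))).continuousAt
  -- By the cone condition the slice t = 0 has no zero of h on the circle of radius r, while it has
  -- one at the centre; Hurwitz carries a zero over to all nearby slices.
  have hzero : ∀ᶠ t : ℂ in 𝓝 0, ∃ s ∈ Metric.closedBall (0 : ℂ) r, h (P t s) = 0 := by
    refine eventually_exists_zero (φ := fun s => h (P 0 s)) hr ?_ ?_ ?_ ?_ ?_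
    · filter_upwards [Metric.closedBall_mem_nhds (0 : ℂ) hr] with t ht
      refine DifferentiableOn.diffContOnCl ?_
      rw [closure_ball _ hr.ne']
      refine hh.comp (by fun_prop) fun s hs => hεU (hrP t s (by simpa using ht) (by simpa using hs))
    · intro s hs
      have : ContinuousAt (fun s : ℂ => h (P 0 s)) s := by
        refine ContinuousAt.comp (f := fun s : ℂ => ((0 : ℂ), s))
          (g := fun p : ℂ × ℂ => h (P p.1 p.2)) (hhP 0 s (by simp [hr.le]) ?_) (by fun_prop)
        exact (by simpa using hs : ‖s‖ = r).le
      exact this.continuousWithinAt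
    · intro s hs
      rw [← nhds_prod_eq]
      exact hhP 0 s (by simp [hr.le]) (by simpa using hs : ‖s‖ = r).le
    · have h1 := (hhP 0 0 (by simp [hr.le]) (by simp [hr.le])).tendsto.comp
        (f := fun t : ℂ => (t, (0 : ℂ))) (x := 𝓝 0) (by
          have : Continuous fun t : ℂ => (t, (0 : ℂ)) := by fun_prop
          exact this.tendsto 0)
      simpa [P, hha, Function.comp_def] using h1
    · intro s hs h0
      have hsr : ‖s‖ = r := by simpa using hs
      have := hcone (P 0 s) (hrP 0 s (by simp [hr.le]) hsr.le) a (Metric.mem_ball_self hε) h0 hha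
        s 0 (by simp [P])
      simp only [norm_zero, mul_zero] at this
      linarith
  obtain ⟨δ, hδ, hball⟩ := Metric.nhds_basis_closedBall.mem_iff.1
    (hzero.and (Metric.closedBall_mem_nhds (0 : ℂ) hr))
  have hex : ∀ t : ℝ, t ∈ Set.Icc 0 δ → ‖(t : ℂ)‖ ≤ r ∧ ∃ s : ℂ, ‖s‖ ≤ r ∧ h (P t s) = 0 := by
    intro t ht
    have := hball (a := (t : ℂ)) (by simpa [abs_of_nonneg ht.1] using ht.2)
    simpa using this.symm
  -- The zeros are picked arbitrarily in each slice; the cone condition alone makes the resulting γ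
  -- Lipschitz.
  choose! hδr s hsr hs0 using hex
  let γ : ℝ → E := fun t => P t (s t)
  have hγmem : ∀ t ∈ Set.Icc 0 δ, γ t ∈ Metric.ball a ε := fun t ht => hrP _ _ (hδr t ht) (hsr t ht)
  have hγlip : ∀ t ∈ Set.Icc 0 δ, ∀ t' ∈ Set.Icc 0 δ,
      ‖γ t' - γ t‖ ≤ (C * ‖v‖ + ‖w‖) * ‖t' - t‖ := by
    intro t ht t' ht'
    have hd : γ t' - γ t = (s t' - s t) • v + ((t' : ℂ) - t) • w := by
      simp only [γ, P]; module
    have h1 := hcone _ (hγmem t' ht') _ (hγmem t ht) (hs0 t' ht') (hs0 t ht) _ _ hd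
    have h2 : ‖(t' : ℂ) - t‖ = ‖t' - t‖ := by rw [← Complex.ofReal_sub, Complex.norm_real]
    rw [hd]
    refine (norm_add_le _ _).trans ?_
    rw [norm_smul, norm_smul, h2]
    rw [h2] at h1
    nlinarith [norm_nonneg v]
  -- The curve γ need not be differentiable: the derivative of f vanishes along it, so an o of a
  -- Lipschitz increment suffices.
  have hder : ∀ t ∈ Set.Icc 0 δ, HasDerivWithinAt (f ∘ γ) ((fun _ => (0 : F)) t) (Set.Icc 0 δ) t := by
    intro t ht
    have hfd : HasFDerivAt f (0 : E →L[ℂ] F) (γ t) := by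
      rw [← hhf (γ t) (hεU (hγmem t ht)) (hs0 t ht)]
      exact (hf.differentiableAt (hU.mem_nhds (hεU (hγmem t ht)))).hasFDerivAt
    have hO : (fun t' => γ t' - γ t) =O[𝓝[Set.Icc 0 δ] t] fun t' => t' - t :=
      Asymptotics.IsBigO.of_bound _ (eventually_mem_nhdsWithin.mono fun t' ht' => hγlip t ht t' ht')
    have hγc : Tendsto γ (𝓝[Set.Icc 0 δ] t) (𝓝 (γ t)) := by
      rw [tendsto_iff_norm_sub_tendsto_zero]
      refine (hO.trans_tendsto ?_).norm.congr' ?_ |>.trans (by simp)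
      · have : Continuous fun t' : ℝ => t' - t := by fun_prop
        simpa using (this.tendsto t).mono_left nhdsWithin_le_nhds
      · exact Eventually.of_forall fun _ => rfl
    rw [hasDerivWithinAt_iff_isLittleO]
    have := (hfd.isLittleO.comp_tendsto hγc).trans_isBigO hO
    simpa [Function.comp_def] using this
  have h0mem : (0 : ℝ) ∈ Set.Icc 0 δ := ⟨le_rfl, hδ.le⟩
  have hδmem : δ ∈ Set.Icc 0 δ := ⟨hδ.le, le_rfl⟩
  have hconst := Convex.norm_image_sub_le_of_norm_hasDerivWithin_le hder (C := 0) (by simp)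
    (convex_Icc 0 δ) h0mem hδmem
  have heq : f (γ δ) = f (γ 0) := by simpa [sub_eq_zero] using hconst
  have hγeq := hinj (hεU (hγmem δ hδmem)) (hεU (hγmem 0 h0mem)) heq
  have h0 : (s δ - s 0) • v + (δ : ℂ) • w = 0 := by
    rw [← sub_eq_zero] at hγeq
    rw [← hγeq]
    simp only [γ, P, Complex.ofReal_zero]; module
  exact hδ.ne' (by simpa using hvw _ _ h0)

/-- A holomorphic function with a zero of finite order has a directional derivative that vanishes
on its whole zero set, and which is nondegenerate at some zero. -/
theorem exists_nondegenerate_of_zero [FiniteDimensional ℂ E] {h : E → ℂ} {U : Set E}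
    (hU : IsOpen U) (hh : DifferentiableOn ℂ h U) {a₀ : E} (ha₀ : a₀ ∈ U) (h0 : h a₀ = 0)
    (hne : ¬ ∀ᶠ z in 𝓝 a₀, h z = 0) :
    ∃ a ∈ U, h a = 0 ∧ ∃ v : E, v ≠ 0 ∧ ∃ u : E → ℂ, DifferentiableOn ℂ u U ∧
      (∀ z ∈ U, h z = 0 → u z = 0) ∧ fderiv ℂ u a v ≠ 0 := by
  obtain ⟨ρ, hρ, hball⟩ := Metric.isOpen_iff.1 hU a₀ ha₀
  obtain ⟨b, hb, hhb⟩ : ∃ b ∈ Metric.ball a₀ ρ, h b ≠ 0 := by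
    by_contra! hcon
    exact hne (by filter_upwards [Metric.ball_mem_nhds a₀ hρ] with z hz using hcon z hz)
  set v := b - a₀ with hv
  have hv0 : v ≠ 0 := by
    intro hv0
    exact hhb (by rw [sub_eq_zero.1 hv0, h0])
  have hvpos : 0 < ‖v‖ := norm_pos_iff.2 hv0
  let D : ℕ → E → ℂ := fun j => Nat.rec h (fun _ u z => fderiv ℂ u z v) j
  have hD : ∀ j, DifferentiableOn ℂ (D j) U := by
    intro j
    induction j with
    | zero => exact hh
    | succ j ih => exact ih.fderiv_apply_of_isOpen hU v
  have hline : ∀ s ∈ Metric.ball (0 : ℂ) (ρ / ‖v‖), a₀ + s • v ∈ Metric.ball a₀ ρ := by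
    intro s hs
    rw [mem_ball_zero_iff, lt_div_iff₀ hvpos] at hs
    simpa [mem_ball_iff_norm, norm_smul] using hs
  have hit : ∀ j, ∀ s ∈ Metric.ball (0 : ℂ) (ρ / ‖v‖),
      iteratedDeriv j (fun s : ℂ => h (a₀ + s • v)) s = D j (a₀ + s • v) := by
    intro j
    induction j with
    | zero => intro s _; simp [D]
    | succ j ih =>
      intro s hs
      rw [iteratedDeriv_succ]
      have hev : iteratedDeriv j (fun s : ℂ => h (a₀ + s • v)) =ᶠ[𝓝 s]
          fun s => D j (a₀ + s • v) := by
        filter_upwards [Metric.isOpen_ball.mem_nhds hs] with y hy using ih y hy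
      rw [hev.deriv_eq]
      have h1 : HasDerivAt (fun s : ℂ => a₀ + s • v) v s := by
        simpa using ((hasDerivAt_id s).smul_const v).const_add a₀
      exact (((hD j).differentiableAt (hU.mem_nhds (hball (hline s hs)))).hasFDerivAt.comp_hasDerivAt
        s h1).deriv
  -- Otherwise the Taylor series of h along the line from a₀ to b vanishes, forcing h b = 0.
  have hex : ∃ j, ∃ a ∈ U, h a = 0 ∧ D j a ≠ 0 := by
    by_contra! hcon
    have hρv : 1 < ρ / ‖v‖ := by
      rw [one_lt_div hvpos]
      exact mem_ball_iff_norm.1 hb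
    have hsum := Complex.hasSum_taylorSeries_on_ball (f := fun s : ℂ => h (a₀ + s • v)) (c := 0)
      (r := ρ / ‖v‖) (hh.comp (by fun_prop) fun s hs => hball (hline s hs)) (z := 1)
      (by simpa using hρv)
    have hz : ∀ n, iteratedDeriv n (fun s : ℂ => h (a₀ + s • v)) 0 = 0 := by
      intro n
      rw [hit n 0 (by simp; positivity)]
      simpa using hcon n a₀ ha₀ h0
    simp only [hz, smul_zero] at hsum
    have := hsum.unique hasSum_zero
    exact hhb (by simpa [hv] using this)
  -- The least such j is positive because D 0 = h. By minimality D (j - 1) vanishes on the whole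
  -- zero set, and its derivative along v at a is D j a.
  obtain ⟨j, ⟨a, ha, hha, hDa⟩, hmin⟩ : ∃ j, (∃ a ∈ U, h a = 0 ∧ D j a ≠ 0) ∧
      ∀ k < j, ¬ ∃ a ∈ U, h a = 0 ∧ D k a ≠ 0 := by
    classical
    exact ⟨Nat.find hex, Nat.find_spec hex, fun k hk => Nat.find_min hex hk⟩
  rcases j with _ | k
  · exact absurd hha hDa
  · refine ⟨a, ha, hha, v, hv0, D k, hD k, fun z hz hhz => not_not.1 fun hne' => ?_, hDa⟩
    exact hmin k (by omega) ⟨z, hz, hhz, hne'⟩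

end Osgood

/-! ### Osgood's theorem and holomorphic inverses -/

section InverseHolomorphic

theorem ContinuousLinearMap.differentiable_det {E : Type*} [NormedAddCommGroup E]
    [NormedSpace ℂ E] [FiniteDimensional ℂ E] :
    Differentiable ℂ fun A : E →L[ℂ] E => LinearMap.det (A : E →ₗ[ℂ] E) := by
  let b := Module.finBasis ℂ E
  have h : (fun A : E →L[ℂ] E => LinearMap.det (A : E →ₗ[ℂ] E)) = fun A =>
      ∑ σ : Equiv.Perm (Fin (Module.finrank ℂ E)), ((Equiv.Perm.sign σ : ℤ) : ℂ) *
        ∏ i, (LinearMap.toContinuousLinearMap (b.coord (σ i))) (A (b i)) := by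
    funext A
    rw [← LinearMap.det_toMatrix b, Matrix.det_apply']
    simp [LinearMap.toMatrix_apply]
  rw [h]
  fun_prop

theorem ContinuousLinearMap.det_ne_zero_iff_injective {E : Type*} [NormedAddCommGroup E]
    [NormedSpace ℂ E] [FiniteDimensional ℂ E] (A : E →L[ℂ] E) :
    LinearMap.det (A : E →ₗ[ℂ] E) ≠ 0 ↔ Function.Injective A := by
  rw [ne_eq, LinearMap.det_eq_zero_iff_ker_ne_bot, not_not, LinearMap.ker_eq_bot]
  rfl

/-- The inductive step of Osgood's theorem at a point where the derivative does not vanish. -/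
theorem injective_fderiv_of_ne_zero {n : ℕ}
    (ih : ∀ (E F : Type) [NormedAddCommGroup E] [NormedSpace ℂ E] [NormedAddCommGroup F]
      [NormedSpace ℂ F] [FiniteDimensional ℂ E] [FiniteDimensional ℂ F],
      Module.finrank ℂ E = n → Module.finrank ℂ F = n → ∀ (f : E → F) (U : Set E), IsOpen U →
        DifferentiableOn ℂ f U → Set.InjOn f U → ∀ a ∈ U, Function.Injective (fderiv ℂ f a))
    {E F : Type} [NormedAddCommGroup E] [NormedSpace ℂ E] [NormedAddCommGroup F]
    [NormedSpace ℂ F] [FiniteDimensional ℂ E] [FiniteDimensional ℂ F]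
    (hE : Module.finrank ℂ E = n + 1) (hF : Module.finrank ℂ F = n + 1) {f : E → F} {U : Set E}
    (hU : IsOpen U) (hf : DifferentiableOn ℂ f U) (hinj : Set.InjOn f U) {a : E} (ha : a ∈ U)
    (hfa : fderiv ℂ f a ≠ 0) : Function.Injective (fderiv ℂ f a) := by
  have : CompleteSpace E := FiniteDimensional.complete ℂ E
  obtain ⟨v, hv⟩ : ∃ v, fderiv ℂ f a v ≠ 0 := by
    by_contra! h
    exact hfa (ContinuousLinearMap.ext h)
  set w := fderiv ℂ f a v with hw
  obtain ⟨ℓ, hℓ⟩ : ∃ ℓ : StrongDual ℂ F, ℓ w = 1 := SeparatingDual.exists_eq_one hv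
  set φ' : StrongDual ℂ E := ℓ ∘L fderiv ℂ f a with hφ'
  have hφ'v : φ' v = 1 := hℓ
  let φ : E → ℂ := fun z => ℓ (f z)
  have hφd : DifferentiableOn ℂ φ U := ℓ.differentiable.comp_differentiableOn hf
  have hφa : HasFDerivAt φ φ' a :=
    ℓ.hasFDerivAt.comp a (hf.differentiableAt (hU.mem_nhds ha)).hasFDerivAt
  -- a chart in which `φ - φ a` is the linear form `φ'`
  let Ψ : E → E := fun z => z - a + (φ z - φ a - φ' (z - a)) • v
  have hΨd : DifferentiableOn ℂ Ψ U := by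
    refine DifferentiableOn.add (by fun_prop) (DifferentiableOn.smul_const ?_ v)
    refine (hφd.sub_const _).sub ?_
    exact (φ'.differentiable.comp (differentiable_id.sub_const a)).differentiableOn
  have hΨa : Ψ a = 0 := by simp [Ψ]
  have hφΨ : ∀ z, φ' (Ψ z) = φ z - φ a := by
    intro z
    simp only [Ψ, map_add, map_smul, hφ'v, smul_eq_mul, mul_one]
    ring
  -- The correction added to z - a in Ψ has zero derivative at a, so the inverse function theorem
  -- applies with the identity.
  have hΨ' : HasFDerivAt Ψ ((ContinuousLinearEquiv.refl ℂ E : E ≃L[ℂ] E) : E →L[ℂ] E) a := by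
    have h1 : HasFDerivAt (fun z : E => z - a) (ContinuousLinearMap.id ℂ E) a :=
      (hasFDerivAt_id a).sub_const a
    have h2 := h1.add (((hφa.sub_const (φ a)).sub (φ'.hasFDerivAt.comp a h1)).smul_const v)
    convert! h2 using 1
    ext x
    simp
  have hΨc : ContDiffAt ℂ 1 Ψ a := hΨd.contDiffAt_one hU ha
  let Θ := hΨc.localInverse hΨ' one_ne_zero
  have hΘ0 : Θ 0 = a := by
    have := hΨc.localInverse_apply_image hΨ' one_ne_zero
    rwa [hΨa] at this
  have hΘc : ContDiffAt ℂ 1 Θ 0 := by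
    have := hΨc.to_localInverse hΨ' one_ne_zero
    rwa [hΨa] at this
  have hΨΘ : ∀ᶠ y in 𝓝 (0 : E), Ψ (Θ y) = y := by
    have := (hΨc.hasStrictFDerivAt' hΨ' one_ne_zero).eventually_right_inverse
    rwa [hΨa] at this
  have hΘ' : HasFDerivAt Θ (ContinuousLinearMap.id ℂ E) 0 := by
    have := (hΨc.hasStrictFDerivAt' hΨ' one_ne_zero).to_localInverse.hasFDerivAt
    rwa [hΨa] at this
  have hΘU : ∀ᶠ y in 𝓝 (0 : E), Θ y ∈ U :=
    hΘc.continuousAt.eventually_mem (by rw [hΘ0]; exact hU.mem_nhds ha)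
  have hΘd : ∀ᶠ y in 𝓝 (0 : E), DifferentiableAt ℂ Θ y :=
    (hΘc.eventually (by simp)).mono fun y hy => hy.differentiableAt one_ne_zero
  obtain ⟨r, hr, hball⟩ := Metric.mem_nhds_iff.1 (hΨΘ.and (hΘU.and hΘd))
  -- restrict to the kernel of `φ'` and project to the kernel of `ℓ`
  let K := φ'.ker
  let π : F →L[ℂ] ℓ.ker :=
    (ContinuousLinearMap.id ℂ F - ℓ.smulRight w).codRestrict ℓ.ker (by
      intro y
      simp [LinearMap.mem_ker, hℓ])
  have hπ : ∀ y, (π y : F) = y - ℓ y • w := fun y => by simp [π]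
  let h : K → ℓ.ker := fun k => π (f (Θ k))
  have hKb : ∀ k ∈ Metric.ball (0 : K) r, (k : E) ∈ Metric.ball (0 : E) r := by
    intro k hk
    simpa using hk
  have hhd : DifferentiableOn ℂ h (Metric.ball 0 r) := by
    intro k hk
    apply DifferentiableAt.differentiableWithinAt
    obtain ⟨-, h2, h3⟩ := hball (hKb k hk)
    have h4 : DifferentiableAt ℂ (fun k : K => Θ (k : E)) k :=
      DifferentiableAt.comp (g := Θ) (f := fun k : K => (k : E)) k h3 K.subtypeL.differentiableAt
    have h5 : DifferentiableAt ℂ (fun k : K => f (Θ (k : E))) k :=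
      DifferentiableAt.comp (g := f) (f := fun k : K => Θ (k : E)) k
        (hf.differentiableAt (hU.mem_nhds h2)) h4
    exact π.differentiableAt.comp k h5
  have hφK : ∀ k ∈ Metric.ball (0 : K) r, φ (Θ k) = φ a := by
    intro k hk
    have h1 := hφΨ (Θ k)
    rw [(hball (hKb k hk)).1, show φ' (k : E) = 0 from k.2] at h1
    exact (sub_eq_zero.1 h1.symm)
  -- On the kernel of φ' the ℓ-component of f ∘ Θ is constant, so projecting it away loses no
  -- information.
  have hhinj : Set.InjOn h (Metric.ball 0 r) := by
    intro k hk k' hk' heq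
    have h1 : (π (f (Θ k)) : F) = π (f (Θ k')) := congrArg Subtype.val heq
    rw [hπ, hπ, show ℓ (f (Θ k)) = ℓ (f (Θ k')) from (hφK k hk).trans (hφK k' hk').symm] at h1
    have h2 := hinj (hball (hKb k hk)).2.1 (hball (hKb k' hk')).2.1 (sub_left_inj.1 h1)
    have h3 : (k : E) = k' := by
      rw [← (hball (hKb k hk)).1, ← (hball (hKb k' hk')).1, h2]
    exact Subtype.ext h3
  have hKdim : Module.finrank ℂ K = n := by
    have hne : (φ' : Module.Dual ℂ E) ≠ 0 := by
      intro h0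
      have : φ' v = 0 := by simpa using congrArg (fun ψ : Module.Dual ℂ E => ψ v) h0
      simp [hφ'v] at this
    have := Module.Dual.finrank_ker_add_one_of_ne_zero hne
    rw [hE] at this
    exact Nat.succ_injective this
  have hLdim : Module.finrank ℂ ℓ.ker = n := by
    have hne : (ℓ : Module.Dual ℂ F) ≠ 0 := by
      intro h0
      have : ℓ w = 0 := by simpa using congrArg (fun ψ : Module.Dual ℂ F => ψ w) h0
      simp [hℓ] at this
    have := Module.Dual.finrank_ker_add_one_of_ne_zero hne
    rw [hF] at this
    exact Nat.succ_injective this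
  have hinj0 := ih K ℓ.ker hKdim hLdim h (Metric.ball 0 r) Metric.isOpen_ball hhd hhinj 0
    (Metric.mem_ball_self hr)
  have hh' : HasFDerivAt h (π ∘L (fderiv ℂ f a ∘L K.subtypeL)) 0 := by
    have h1 : HasFDerivAt (fun k : K => Θ (k : E)) K.subtypeL 0 := by
      have := HasFDerivAt.comp (g := Θ) (f := fun k : K => (k : E)) (0 : K) (by simpa using hΘ')
        K.subtypeL.hasFDerivAt
      exact this
    have h2 : HasFDerivAt (fun k : K => f (Θ (k : E))) (fderiv ℂ f a ∘L K.subtypeL) 0 := by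
      refine HasFDerivAt.comp (g := f) (f := fun k : K => Θ (k : E)) (0 : K) ?_ h1
      simp only [ZeroMemClass.coe_zero, hΘ0]
      exact (hf.differentiableAt (hU.mem_nhds ha)).hasFDerivAt
    exact π.hasFDerivAt.comp (0 : K) h2
  rw [hh'.fderiv] at hinj0
  rw [injective_iff_map_eq_zero]
  intro x hx
  have hxK : x ∈ K := by
    change ℓ (fderiv ℂ f a x) = 0
    rw [hx, map_zero]
  have h1 := (injective_iff_map_eq_zero _).1 hinj0 ⟨x, hxK⟩ (by simp [hx])
  simpa using h1

/-- Osgood's theorem: an injective holomorphic map between spaces of equal dimension has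
injective derivatives. -/
theorem injective_fderiv_of_injOn_aux (n : ℕ) :
    ∀ (E F : Type) [NormedAddCommGroup E] [NormedSpace ℂ E] [NormedAddCommGroup F]
      [NormedSpace ℂ F] [FiniteDimensional ℂ E] [FiniteDimensional ℂ F],
      Module.finrank ℂ E = n → Module.finrank ℂ F = n → ∀ (f : E → F) (U : Set E), IsOpen U →
        DifferentiableOn ℂ f U → Set.InjOn f U → ∀ a ∈ U, Function.Injective (fderiv ℂ f a) := by
  induction n with
  | zero =>
    intro E F _ _ _ _ _ _ hE _ f U _ _ _ a _
    have : Subsingleton E := Module.finrank_zero_iff.1 hE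
    exact Function.injective_of_subsingleton _
  | succ n ih =>
    intro E F _ _ _ _ _ _ hE hF f U hU hf hinj a ha
    have : Nontrivial E := Module.nontrivial_of_finrank_pos (R := ℂ) (by omega)
    have hstep : ∀ z ∈ U, fderiv ℂ f z ≠ 0 → Function.Injective (fderiv ℂ f z) := fun z hz =>
      injective_fderiv_of_ne_zero ih hE hF hU hf hinj hz
    refine hstep a ha fun hfa => ?_
    -- Dimension one is separate because the argument with the curve of critical points needs a
    -- direction w independent of v.
    rcases Nat.eq_zero_or_pos n with rfl | hn
    · obtain ⟨v, hv⟩ := exists_ne (0 : E)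
      obtain ⟨y, hy⟩ := finrank_eq_one_iff'.1 hF
      have hb : ∀ x : F, ∃ c : ℂ, c • y = x := hy.2
      obtain ⟨ℓ, hℓ⟩ : ∃ ℓ : StrongDual ℂ F, ℓ y = 1 := SeparatingDual.exists_eq_one hy.1
      have hℓinj : Function.Injective ℓ := by
        rw [injective_iff_map_eq_zero]
        intro x hx
        obtain ⟨c, rfl⟩ := hb x
        have : c = 0 := by simpa [hℓ] using hx
        simp [this]
      let V : Set ℂ := (fun s : ℂ => a + s • v) ⁻¹' U
      have hV : IsOpen V := hU.preimage (by fun_prop)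
      have h0V : (0 : ℂ) ∈ V := by simpa [V] using ha
      have hψd : DifferentiableOn ℂ (fun s : ℂ => ℓ (f (a + s • v))) V :=
        ℓ.differentiable.comp_differentiableOn (hf.comp (by fun_prop) fun s hs => hs)
      have hψi : Set.InjOn (fun s : ℂ => ℓ (f (a + s • v))) V := by
        intro s hs t ht hst
        have := hinj hs ht (hℓinj hst)
        exact smul_left_injective ℂ hv (add_left_cancel this)
      refine deriv_ne_zero_of_injOn hV hψd hψi h0V ?_
      have h1 : HasDerivAt (fun s : ℂ => a + s • v) v 0 := by
        simpa using ((hasDerivAt_id (0 : ℂ)).smul_const v).const_add a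
      have h2 : HasFDerivAt f (0 : E →L[ℂ] F) (a + (0 : ℂ) • v) := by
        rw [zero_smul, add_zero, ← hfa]
        exact (hf.differentiableAt (hU.mem_nhds ha)).hasFDerivAt
      have h3 := ℓ.hasFDerivAt.comp_hasDerivAt (0 : ℂ) (h2.comp_hasDerivAt (0 : ℂ) h1)
      simpa using! h3.deriv
    · let e : F ≃L[ℂ] E := ContinuousLinearEquiv.ofFinrankEq (hF.trans hE.symm)
      let h : E → ℂ := fun z =>
        LinearMap.det (((e : F →L[ℂ] E) ∘L fderiv ℂ f z : E →L[ℂ] E) : E →ₗ[ℂ] E)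
      have hhd : DifferentiableOn ℂ h U := by
        have h1 : DifferentiableOn ℂ (fun z => (e : F →L[ℂ] E) ∘L fderiv ℂ f z) U :=
          (differentiableOn_const _).clm_comp (hf.differentiableOn_fderiv hU)
        exact Differentiable.comp_differentiableOn
          (g := fun A : E →L[ℂ] E => LinearMap.det (A : E →ₗ[ℂ] E))
          ContinuousLinearMap.differentiable_det h1
      -- By `hstep` a derivative is either zero or injective, so the zeros of the Jacobian are
      -- exactly those of the derivative.
      have hhf : ∀ z ∈ U, h z = 0 → fderiv ℂ f z = 0 := by
        intro z hz hhz
        by_contra hne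
        refine (ContinuousLinearMap.det_ne_zero_iff_injective _).2 ?_ hhz
        exact e.injective.comp (hstep z hz hne)
      have hha : h a = 0 := by
        by_contra hne
        have := (ContinuousLinearMap.det_ne_zero_iff_injective _).1 hne
        obtain ⟨v, hv⟩ := exists_ne (0 : E)
        exact hv (this (by simp [hfa]))
      have hnev : ¬ ∀ᶠ z in 𝓝 a, h z = 0 := by
        intro hev
        obtain ⟨ρ, hρ, hball⟩ := Metric.mem_nhds_iff.1 (hev.and (hU.mem_nhds ha))
        obtain ⟨v, hv⟩ := exists_ne (0 : E)
        have hvn : 0 < ‖v‖ := norm_pos_iff.2 hv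
        have hmem : a + ((ρ / 2 / ‖v‖ : ℝ) : ℂ) • v ∈ Metric.ball a ρ := by
          rw [mem_ball_iff_norm, add_sub_cancel_left, norm_smul, Complex.norm_real,
            Real.norm_of_nonneg (by positivity), div_mul_cancel₀ _ hvn.ne']
          linarith
        have heq : f (a + ((ρ / 2 / ‖v‖ : ℝ) : ℂ) • v) = f a := by
          let : NormedSpace ℝ E := NormedSpace.restrictScalars ℝ ℂ E
          exact Metric.isOpen_ball.is_const_of_fderiv_eq_zero (𝕜 := ℂ)
            (convex_ball a ρ).isPreconnected (hf.mono fun z hz => (hball hz).2)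
            (fun z hz => hhf z (hball hz).2 (hball hz).1) hmem (Metric.mem_ball_self hρ)
        have := hinj (hball hmem).2 ha heq
        rw [add_eq_left, smul_eq_zero] at this
        rcases this with h0 | h0
        · have : ρ / 2 / ‖v‖ = 0 := by exact_mod_cast h0
          have hpos : 0 < ρ / 2 / ‖v‖ := by positivity
          exact hpos.ne' this
        · exact hv h0
      obtain ⟨b, hb, hhb, v, hv, u, hu, huh, hub⟩ :=
        exists_nondegenerate_of_zero hU hhd ha hha hnev
      obtain ⟨w, hw⟩ : ∃ w : E, w ∉ Submodule.span ℂ {v} := by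
        by_contra! hcon
        have htop : Submodule.span ℂ {v} = ⊤ := by
          rw [eq_top_iff]
          exact fun x _ => hcon x
        have h1 := finrank_span_singleton (K := ℂ) hv
        rw [htop, finrank_top] at h1
        omega
      refine false_of_injOn_of_fderiv_eq_zero hU hf hinj hhd hhf hu huh hb hhb hub
        (w := w) fun s t hst => ?_
      by_contra ht
      refine hw (Submodule.mem_span_singleton.2 ⟨-(t⁻¹ * s), ?_⟩)
      have : w = t⁻¹ • (t • w) := by rw [smul_smul, inv_mul_cancel₀ ht, one_smul]
      rw [this, eq_neg_of_add_eq_zero_right hst]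
      module

theorem injective_fderiv_of_injOn {E F : Type} [NormedAddCommGroup E] [NormedSpace ℂ E]
    [NormedAddCommGroup F] [NormedSpace ℂ F] [FiniteDimensional ℂ E] [FiniteDimensional ℂ F]
    (hEF : Module.finrank ℂ E = Module.finrank ℂ F) {f : E → F} {U : Set E} (hU : IsOpen U)
    (hf : DifferentiableOn ℂ f U) (hinj : Set.InjOn f U) {a : E} (ha : a ∈ U) :
    Function.Injective (fderiv ℂ f a) :=
  injective_fderiv_of_injOn_aux _ E F hEF rfl f U hU hf hinj a ha

/-- The inverse of an injective holomorphic map between spaces of equal dimension is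
holomorphic. -/
theorem differentiableAt_invFunOn {E F : Type} [NormedAddCommGroup E] [NormedSpace ℂ E]
    [NormedAddCommGroup F] [NormedSpace ℂ F] [FiniteDimensional ℂ E] [FiniteDimensional ℂ F]
    (hEF : Module.finrank ℂ E = Module.finrank ℂ F) {f : E → F} {U : Set E} (hU : IsOpen U)
    (hf : DifferentiableOn ℂ f U) (hinj : Set.InjOn f U) {a : E} (ha : a ∈ U) :
    DifferentiableAt ℂ (Function.invFunOn f U) (f a) := by
  have : CompleteSpace E := FiniteDimensional.complete ℂ E
  let A : E ≃L[ℂ] F := ContinuousLinearEquiv.ofBijective (fderiv ℂ f a)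
    (LinearMap.ker_eq_bot.2 (injective_fderiv_of_injOn hEF hU hf hinj ha))
    (LinearMap.range_eq_top.2 ((LinearMap.injective_iff_surjective_of_finrank_eq_finrank hEF).1
      (injective_fderiv_of_injOn hEF hU hf hinj ha)))
  have hA : HasStrictFDerivAt f (A : E →L[ℂ] F) a := hf.hasStrictFDerivAt hU ha
  refine (hA.to_localInverse.hasFDerivAt.congr_of_eventuallyEq ?_).differentiableAt
  have hmem : ∀ᶠ y in 𝓝 (f a), hA.localInverse f A a y ∈ U :=
    hA.localInverse_continuousAt.eventually_mem (by
      rw [hA.localInverse_apply_image]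
      exact hU.mem_nhds ha)
  filter_upwards [hmem, hA.eventually_right_inverse] with y hy1 hy2
  have := hinj.leftInvOn_invFunOn hy1
  rwa [hy2] at this

end InverseHolomorphic

/-! ### Convex sets under local Hausdorff convergence -/

section LocalHausdorff

variable {d : ℕ}

/-- Limits of points of the approximating sets lie in the closure of the limit set. -/
theorem LocalHausdorffConverges.mem_closure_of_tendsto {A : ℕ → Set (CSpace d)}
    {B : Set (CSpace d)} (hAB : LocalHausdorffConverges A B) {ι : Type*} {l : Filter ι} [l.NeBot]
    {φ : ι → ℕ} (hφ : Tendsto φ l atTop) {y : ι → CSpace d} {p : CSpace d}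
    (hy : ∀ᶠ i in l, y i ∈ A (φ i)) (hp : Tendsto y l (𝓝 p)) : p ∈ closure B := by
  obtain ⟨R₀, -, hR⟩ := hAB
  set R := max R₀ (‖p‖ + 1) with hRdef
  rw [← closure_closure, Metric.mem_closure_iff]
  intro ε hε
  have h1 := ((hR R (le_max_left _ _)).comp hφ).eventually_lt_const
    (u := ENNReal.ofReal (ε / 2)) (by simpa using hε)
  have h2 : ∀ᶠ i in l, dist (y i) p < ε / 2 := hp.eventually (Metric.ball_mem_nhds p (half_pos hε))
  have h3 : ∀ᶠ i in l, ‖y i‖ < ‖p‖ + 1 := hp.norm.eventually_lt_const (lt_add_one _)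
  obtain ⟨i, h1, h2, h3, h4⟩ := (h1.and (h2.and (h3.and hy))).exists
  have hmem : y i ∈ closure (A (φ i)) ∩ Metric.closedBall 0 R :=
    ⟨subset_closure h4, mem_closedBall_zero_iff.2 (h3.le.trans (le_max_right _ _))⟩
  obtain ⟨b, hb, hyb⟩ := Metric.exists_edist_lt_of_hausdorffEDist_lt hmem h1
  refine ⟨b, hb.1, ?_⟩
  rw [edist_dist, ENNReal.ofReal_lt_ofReal_iff (half_pos hε)] at hyb
  linarith [dist_triangle_left p b (y i)]

/-- A point of the limit set has a neighbourhood contained in almost all approximating sets. -/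
theorem LocalHausdorffConverges.eventually_ball_subset {A : ℕ → Set (CSpace d)}
    {B : Set (CSpace d)} (hAB : LocalHausdorffConverges A B) (hA : ∀ n, IsOpen (A n))
    (hAc : ∀ n, Convex ℝ (A n)) (hB : IsOpen B) {p : CSpace d} (hp : p ∈ B) :
    ∃ ρ > 0, ∀ᶠ n in atTop, Metric.ball p ρ ⊆ A n := by
  obtain ⟨R₀, -, hR⟩ := hAB
  obtain ⟨δ, hδ, hball⟩ := Metric.isOpen_iff.1 hB p hp
  set ρ := δ / 2 with hρ
  have hρ0 : 0 < ρ := half_pos hδ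
  set R := max R₀ (‖p‖ + δ) with hRdef
  refine ⟨ρ, hρ0, ?_⟩
  have h1 := (hR R (le_max_left _ _)).eventually_lt_const
    (u := ENNReal.ofReal (ρ / 2)) (by simpa using hρ0)
  filter_upwards [h1] with n hn
  have happrox : ∀ q ∈ Metric.ball p δ, ∃ y ∈ closure (A n), dist q y < ρ / 2 := by
    intro q hq
    have hq' : q ∈ closure B ∩ Metric.closedBall 0 R := by
      refine ⟨subset_closure (hball hq), ?_⟩
      rw [mem_closedBall_zero_iff]
      have h2 : ‖q - p‖ < δ := mem_ball_iff_norm.1 hq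
      have h3 : ‖q‖ ≤ ‖q - p‖ + ‖p‖ := by simpa using norm_add_le (q - p) p
      exact (by linarith : ‖q‖ ≤ ‖p‖ + δ).trans (le_max_right _ _)
    obtain ⟨y, hy, hqy⟩ := Metric.exists_edist_lt_of_hausdorffEDist_lt
      (t := closure (A n) ∩ Metric.closedBall 0 R) hq' (by
        rw [Metric.hausdorffEDist_comm]; exact hn)
    rw [edist_dist, ENNReal.ofReal_lt_ofReal_iff (half_pos hρ0)] at hqy
    exact ⟨y, hy.1, hqy⟩
  have hcl : Metric.ball p ρ ⊆ closure (A n) := by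
    intro q hq
    by_contra hqn
    obtain ⟨f, u, hfu, huq⟩ := geometric_hahn_banach_closed_point (hAc n).closure
      isClosed_closure hqn
    obtain ⟨y₀, hy₀, -⟩ := happrox p (Metric.mem_ball_self hδ)
    have hf0 : 0 < ‖f‖ := by
      rw [norm_pos_iff]
      rintro rfl
      have := (hfu y₀ hy₀).trans huq
      simp at this
    -- Moving q by ρ • w raises f by more than ‖f‖ρ/2 but stays within δ = 2ρ of p, hence within ρ/2
    -- of the closure of A n. This contradicts the separation of q.
    obtain ⟨w, hw1, hw2⟩ : ∃ w : CSpace d, ‖w‖ < 1 ∧ ‖f‖ / 2 < f w := by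
      obtain ⟨w, hw1, hw2⟩ := f.exists_lt_apply_of_lt_opNorm (half_lt_self hf0)
      rcases le_total 0 (f w) with h | h
      · exact ⟨w, hw1, by rwa [Real.norm_of_nonneg h] at hw2⟩
      · exact ⟨-w, by rwa [norm_neg], by rwa [Real.norm_of_nonpos h, ← map_neg] at hw2⟩
    have hq' : q + ρ • w ∈ Metric.ball p δ := by
      rw [mem_ball_iff_norm] at hq ⊢
      have h2 : ‖ρ • w‖ ≤ ρ := by
        rw [norm_smul, Real.norm_of_nonneg hρ0.le]
        nlinarith
      have h3 : q + ρ • w - p = (q - p) + ρ • w := by abel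
      rw [h3]
      linarith [norm_add_le (q - p) (ρ • w)]
    obtain ⟨y, hy, hqy⟩ := happrox _ hq'
    have h4 : f (q + ρ • w) - f y ≤ ‖f‖ * (ρ / 2) := by
      rw [← map_sub]
      refine (le_abs_self _).trans ((f.le_opNorm _).trans ?_)
      rw [← dist_eq_norm]
      gcongr
    have h5 := hfu y hy
    rw [map_add, map_smul, smul_eq_mul] at h4
    nlinarith
  obtain ⟨y₀, hy₀, -⟩ := happrox p (Metric.mem_ball_self hδ)
  have hne : (interior (A n)).Nonempty := by
    rw [(hA n).interior_eq]
    exact closure_nonempty_iff.1 ⟨y₀, hy₀⟩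
  have := (hAc n).interior_closure_eq_interior_of_nonempty_interior hne
  rw [(hA n).interior_eq] at this
  rw [← this]
  exact interior_maximal hcl Metric.isOpen_ball

/-- If the closure of an open convex set contains a complex line, so does the set. -/
theorem Convex.add_smul_mem_of_line_subset_closure {Ω : Set (CSpace d)} (hΩ : IsOpen Ω)
    (hc : Convex ℝ Ω) {x z v : CSpace d} (hx : x ∈ Ω) (h : ∀ ζ : ℂ, z + ζ • v ∈ closure Ω)
    (ζ : ℂ) : x + ζ • v ∈ Ω := by
  -- Chosen so that x = (1 - t) X t + t z. Then x + ζ • v combines the interior point X t with the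
  -- point of the line at parameter ζ/t.
  let X : ℝ → CSpace d := fun t => (1 - t)⁻¹ • (x - t • z)
  have hX : ContinuousAt X 0 := by
    have h1 : ContinuousAt (fun t : ℝ => 1 - t) 0 := by fun_prop
    have h2 : ContinuousAt (fun t : ℝ => x - t • z) 0 := by fun_prop
    exact (h1.inv₀ (by simp)).smul h2
  have hX0 : X 0 = x := by simp [X]
  have hev : ∀ᶠ t in 𝓝[>] (0 : ℝ), X t ∈ Ω :=
    nhdsWithin_le_nhds (hX.eventually_mem (by rw [hX0]; exact hΩ.mem_nhds hx))
  obtain ⟨t, ht, ht1⟩ := (hev.and (Ioo_mem_nhdsGT (zero_lt_one' ℝ))).exists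
  have h1 : 0 < 1 - t := by linarith [ht1.2]
  have := hc.combo_interior_closure_mem_interior (x := X t) (by rwa [hΩ.interior_eq])
    (h (((t⁻¹ : ℝ) : ℂ) * ζ)) h1 ht1.1.le (by ring)
  rw [hΩ.interior_eq] at this
  convert! this using 1
  have h2 : (1 - t) • X t = x - t • z := by simp [X, smul_smul, h1.ne']
  have h3 : t • ((((t⁻¹ : ℝ) : ℂ) * ζ) • v) = ζ • v := by
    rw [← smul_assoc, Complex.real_smul, ← mul_assoc, ← Complex.ofReal_mul,
      mul_inv_cancel₀ ht1.1.ne', Complex.ofReal_one, one_mul]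
  rw [h2, smul_add, h3]
  abel

/-- The affine discs contained in convex sets converging to a convex set without complex lines
grow at most linearly with the distance of their centres. -/
theorem LocalHausdorffConverges.exists_affine_disc_bound {A : ℕ → Set (CSpace d)}
    {Ω : Set (CSpace d)} (hAΩ : LocalHausdorffConverges A Ω) (hAc : ∀ n, Convex ℝ (A n))
    (hΩ : IsOpen Ω) (hc : Convex ℝ Ω)
    (hline : ¬ ∃ a v : CSpace d, v ≠ 0 ∧ ∀ z : ℂ, a + z • v ∈ Ω)
    {y : ℕ → CSpace d} {x : CSpace d} (hy : ∀ n, y n ∈ A n) (hx : x ∈ Ω)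
    (hyx : Tendsto y atTop (𝓝 x)) :
    ∃ M > 0, ∀ᶠ n in atTop, ∀ z h : CSpace d, (∀ ζ : ℂ, ‖ζ‖ < 1 → z + ζ • h ∈ A n) →
      ‖h‖ ≤ M * (1 + ‖z - y n‖) := by
  by_contra! hcon
  have hseq : ∀ j : ℕ, ∃ n ≥ j, ∃ z h : CSpace d, (∀ ζ : ℂ, ‖ζ‖ < 1 → z + ζ • h ∈ A n) ∧
      (j + 1 : ℝ) * (1 + ‖z - y n‖) < ‖h‖ := fun j =>
    frequently_atTop.1 (hcon (j + 1) (by positivity)) j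
  choose φ hφ z h hdisc hlt using hseq
  have hφt : Tendsto φ atTop atTop := tendsto_atTop_mono hφ tendsto_id
  -- Contracting a disc towards y (φ j) by the factor c j stays in the convex set, brings the centre
  -- within distance 1 of y (φ j) and leaves a radius above j + 1.
  let c : ℕ → ℝ := fun j => (1 + ‖z j - y (φ j)‖)⁻¹
  have hcpos : ∀ j, 0 < c j := fun j => by positivity
  have hc1 : ∀ j, c j ≤ 1 := fun j => inv_le_one_of_one_le₀ (by linarith [norm_nonneg (z j - y (φ j))])
  let z' : ℕ → CSpace d := fun j => y (φ j) + c j • (z j - y (φ j))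
  have hz' : ∀ j, ‖z' j - y (φ j)‖ ≤ 1 := by
    intro j
    simp only [z', add_sub_cancel_left, norm_smul, Real.norm_of_nonneg (hcpos j).le, c]
    rw [inv_mul_le_iff₀ (by positivity)]
    linarith
  have hhpos : ∀ j, 0 < ‖h j‖ := fun j => lt_of_le_of_lt (by positivity) (hlt j)
  have hch : ∀ j : ℕ, (j + 1 : ℝ) < c j * ‖h j‖ := by
    intro j
    simp only [c]
    rw [inv_mul_eq_div, lt_div_iff₀ (by positivity)]
    exact hlt j
  let v : ℕ → CSpace d := fun j => ((‖h j‖⁻¹ : ℝ) : ℂ) • h j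
  have hv : ∀ j, ‖v j‖ = 1 := by
    intro j
    simp only [v, norm_smul, Complex.norm_real, norm_inv, norm_norm]
    exact inv_mul_cancel₀ (hhpos j).ne'
  have hdisc' : ∀ j : ℕ, ∀ ζ : ℂ, ‖ζ‖ < j + 1 → z' j + ζ • v j ∈ A (φ j) := by
    intro j ζ hζ
    have hne : c j * ‖h j‖ ≠ 0 := (mul_pos (hcpos j) (hhpos j)).ne'
    have h1 := hdisc j (((c j * ‖h j‖)⁻¹ : ℝ) * ζ) (by
      rw [norm_mul, Complex.norm_real, norm_inv,
        Real.norm_of_nonneg (mul_pos (hcpos j) (hhpos j)).le,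
        inv_mul_lt_iff₀ (mul_pos (hcpos j) (hhpos j)), mul_one]
      exact hζ.trans (hch j))
    have h2 := hAc (φ j) (hy (φ j)) h1 (a := 1 - c j) (b := c j) (by linarith [hc1 j])
      (hcpos j).le (by ring)
    convert! h2 using 1
    have h3 : c j • ((((c j * ‖h j‖)⁻¹ : ℝ) * ζ) • h j) = ζ • v j := by
      simp only [v]
      rw [← smul_assoc, Complex.real_smul, smul_smul, ← mul_assoc, ← Complex.ofReal_mul, mul_inv,
        ← mul_assoc, mul_inv_cancel₀ (hcpos j).ne', one_mul, mul_comm]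
    rw [smul_add, h3]
    simp only [z']
    module
  have hU : ((hyperfilter ℕ : Ultrafilter ℕ) : Filter ℕ) ≤ atTop := Nat.hyperfilter_le_atTop
  have hyφ : Tendsto (fun j => y (φ j)) (hyperfilter ℕ : Filter ℕ) (𝓝 x) :=
    (hyx.comp hφt).mono_left hU
  obtain ⟨p, -, hp⟩ := (isCompact_closedBall (0 : CSpace d) (‖x‖ + 2)).ultrafilter_le_nhds'
    ((hyperfilter ℕ).map z') (by
      have : ∀ᶠ j in (hyperfilter ℕ : Filter ℕ), z' j ∈ Metric.closedBall 0 (‖x‖ + 2) := by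
        filter_upwards [hyφ.norm.eventually_lt_const (lt_add_one _)] with j hj
        rw [mem_closedBall_zero_iff]
        have h1 : ‖z' j‖ ≤ ‖z' j - y (φ j)‖ + ‖y (φ j)‖ := by
          simpa using norm_add_le (z' j - y (φ j)) (y (φ j))
        linarith [hz' j]
      exact this)
  obtain ⟨V, hVs, hV⟩ := (isCompact_sphere (0 : CSpace d) 1).ultrafilter_le_nhds'
    ((hyperfilter ℕ).map v) (by
      have : ∀ᶠ j in (hyperfilter ℕ : Filter ℕ), v j ∈ Metric.sphere 0 1 :=
        Eventually.of_forall fun j => by simpa using hv j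
      exact this)
  have hp' : Tendsto z' (hyperfilter ℕ : Filter ℕ) (𝓝 p) := hp
  have hV' : Tendsto v (hyperfilter ℕ : Filter ℕ) (𝓝 V) := hV
  have hcl : ∀ ζ : ℂ, p + ζ • V ∈ closure Ω := by
    intro ζ
    refine hAΩ.mem_closure_of_tendsto (hφt.mono_left hU) (y := fun j => z' j + ζ • v j) ?_
      (hp'.add (hV'.const_smul ζ))
    have : ∀ᶠ j : ℕ in atTop, ‖ζ‖ < j + 1 := by
      filter_upwards [tendsto_natCast_atTop_atTop.eventually_gt_atTop ‖ζ‖] with j hj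
      linarith
    exact (this.filter_mono hU).mono fun j hj => hdisc' j ζ hj
  refine hline ⟨x, V, ?_, fun ζ => hc.add_smul_mem_of_line_subset_closure hΩ hx hcl ζ⟩
  rintro rfl
  simp at hVs

end LocalHausdorff

/-! ### Holomorphic maps into convex sets -/

section ConvexTarget

variable {d : ℕ}

/-- A Koebe type theorem: the image of the derivative of a holomorphic map into a convex set
contains discs of definite size inside the set. -/
theorem Convex.add_smul_fderiv_mem {C : Set (CSpace d)} (hC : IsOpen C) (hc : Convex ℝ C)
    {g : CSpace d → CSpace d} {w : CSpace d} {ρ : ℝ} (hρ : 0 < ρ)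
    (hg : DifferentiableOn ℂ g (Metric.ball w ρ)) (hgC : Set.MapsTo g (Metric.ball w ρ) C)
    {h : CSpace d} (hh : ‖h‖ ≤ 1) {ζ : ℂ} (hζ : ‖ζ‖ < ρ / 6) :
    g w + ζ • fderiv ℂ g w h ∈ C := by
  by_contra hnot
  obtain ⟨ℓ, hℓ⟩ := RCLike.geometric_hahn_banach_open_point (𝕜 := ℂ) hc hC hnot
  set D : ℂ := ℓ (fderiv ℂ g w h) with hD
  set β : ℝ := RCLike.re (ℓ (g w + ζ • fderiv ℂ g w h)) with hβ
  set τ : ℝ := β - (ℓ (g w)).re with hτ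
  have hτ0 : 0 < τ := sub_pos.2 (hℓ _ (hgC (Metric.mem_ball_self hρ)))
  have hτle : τ ≤ ‖ζ‖ * ‖D‖ := by
    have : τ = (ζ * D).re := by
      simp [hτ, hβ, hD]
    rw [this, ← norm_mul]
    exact Complex.re_le_norm _
  -- The exponential maps a half-space containing C into the unit disc; scaling by τ makes |Φ w| =
  -- 1/e. The Schwarz bound 2/ρ then gives ‖D‖ρ ≤ 2eτ, and 2e < 6 explains the constant 6.
  let Φ : CSpace d → ℂ := fun z => Complex.exp ((τ⁻¹ : ℂ) * (ℓ (g z) - β))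
  have hΦd : DifferentiableOn ℂ Φ (Metric.ball w ρ) := by
    refine DifferentiableOn.cexp (DifferentiableOn.const_mul (DifferentiableOn.sub_const ?_ _) _)
    exact ℓ.differentiable.comp_differentiableOn hg
  have hnorm : ∀ z, ‖Φ z‖ = Real.exp (τ⁻¹ * ((ℓ (g z)).re - β)) := by
    intro z
    simp only [Φ, Complex.norm_exp]
    rw [← Complex.ofReal_inv, Complex.re_ofReal_mul]
    simp
  have hΦ1 : ∀ z ∈ Metric.ball w ρ, ‖Φ z‖ ≤ 1 := by
    intro z hz
    rw [hnorm, Real.exp_le_one_iff]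
    have : (ℓ (g z)).re < β := hℓ _ (hgC hz)
    exact mul_nonpos_of_nonneg_of_nonpos (by positivity) (by linarith)
  have hbound := norm_fderiv_le_of_differentiableOn_ball hρ hΦd hΦ1
  have hder : HasFDerivAt Φ (Φ w • ((τ⁻¹ : ℂ) • (ℓ ∘L fderiv ℂ g w))) w :=
    (((ℓ.hasFDerivAt.comp w (hg.differentiableAt
      (Metric.ball_mem_nhds w hρ)).hasFDerivAt).sub_const _).const_mul _).cexp
  have h1 : ‖fderiv ℂ Φ w h‖ ≤ 2 * 1 / ρ :=
    (ContinuousLinearMap.le_opNorm _ _).trans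
      ((mul_le_of_le_one_right (norm_nonneg _) hh).trans hbound)
  have hΦw : ‖Φ w‖ = Real.exp (-1) := by
    rw [hnorm]
    congr 1
    have : (ℓ (g w)).re - β = -τ := by rw [hτ]; ring
    rw [this]
    field_simp
  have h2 : ‖fderiv ℂ Φ w h‖ = Real.exp (-1) * (τ⁻¹ * ‖D‖) := by
    rw [hder.fderiv]
    simp only [smul_apply, smul_eq_mul, norm_mul, hΦw]
    congr 2
    rw [← Complex.ofReal_inv, Complex.norm_real, Real.norm_of_nonneg (by positivity)]
  rw [h2, Real.exp_neg] at h1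
  have he : Real.exp 1 < 3 := Real.exp_one_lt_three
  have he0 : 0 < Real.exp 1 := Real.exp_pos 1
  have hD0 : 0 < ‖D‖ := by
    by_contra hle
    have : ‖D‖ = 0 := le_antisymm (not_lt.1 hle) (norm_nonneg _)
    rw [this, mul_zero] at hτle
    linarith
  have h3 : ‖D‖ * ρ ≤ 2 * Real.exp 1 * τ := by
    rw [inv_mul_le_iff₀ he0, inv_mul_le_iff₀ hτ0] at h1
    calc ‖D‖ * ρ ≤ τ * (Real.exp 1 * (2 * 1 / ρ)) * ρ := by gcongr
      _ = 2 * Real.exp 1 * τ := by field_simp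
  have h4 : ‖D‖ * ρ < ‖D‖ * ρ := by
    calc ‖D‖ * ρ ≤ 2 * Real.exp 1 * τ := h3
      _ ≤ 6 * τ := by nlinarith
      _ ≤ 6 * (‖ζ‖ * ‖D‖) := by gcongr
      _ < ‖D‖ * ρ := by nlinarith
  exact lt_irrefl _ h4

/-- A holomorphic map from a ball into a convex set whose affine discs grow at most linearly is
bounded on smaller balls in terms of the growth constant. -/
theorem Convex.norm_sub_le_gronwallBound {C : Set (CSpace d)} (hC : IsOpen C) (hc : Convex ℝ C)
    {p : CSpace d} {M : ℝ}
    (hdisc : ∀ z h : CSpace d, (∀ ζ : ℂ, ‖ζ‖ < 1 → z + ζ • h ∈ C) → ‖h‖ ≤ M * (1 + ‖z - p‖))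
    {g : CSpace d → CSpace d} {L r : ℝ} (hL : 0 < L) (hr : r < L)
    (hg : DifferentiableOn ℂ g (Metric.ball 0 L)) (hgC : Set.MapsTo g (Metric.ball 0 L) C)
    (hg0 : g 0 = p) {w : CSpace d} (hw : ‖w‖ ≤ r) :
    ‖g w - p‖ ≤ gronwallBound 0 (6 * L * M / (L - r)) (6 * L * M / (L - r)) 1 := by
  set K := 6 * L * M / (L - r) with hK
  have hLr : 0 < L - r := by linarith
  have hseg : ∀ t ∈ Set.Icc (0 : ℝ) 1, ‖(t : ℂ) • w‖ ≤ r := by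
    intro t ht
    rw [norm_smul, Complex.norm_real, Real.norm_of_nonneg ht.1]
    nlinarith [ht.2, norm_nonneg w]
  have hmem : ∀ t ∈ Set.Icc (0 : ℝ) 1, (t : ℂ) • w ∈ Metric.ball (0 : CSpace d) L := by
    intro t ht
    rw [mem_ball_zero_iff]
    exact (hseg t ht).trans_lt hr
  have hder : ∀ t ∈ Set.Icc (0 : ℝ) 1,
      HasDerivAt (fun t : ℝ => g ((t : ℂ) • w) - p) (fderiv ℂ g ((t : ℂ) • w) w) t := by
    intro t ht
    have h1 : HasDerivAt (fun s : ℂ => s • w) w (t : ℂ) := by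
      simpa using (hasDerivAt_id (t : ℂ)).smul_const w
    have h2 : HasFDerivAt g (fderiv ℂ g ((t : ℂ) • w)) ((t : ℂ) • w) :=
      (hg.differentiableAt (Metric.isOpen_ball.mem_nhds (hmem t ht))).hasFDerivAt
    have h3 : HasDerivAt (fun s : ℂ => g (s • w)) (fderiv ℂ g ((t : ℂ) • w) w) (t : ℂ) :=
      HasFDerivAt.comp_hasDerivAt (f := fun s : ℂ => s • w) (t : ℂ) h2 h1
    have h4 : HasDerivAt (fun t : ℝ => (t : ℂ)) 1 t := Complex.ofRealCLM.hasDerivAt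
    have h5 := HasDerivAt.scomp t h3 h4
    rw [one_smul] at h5
    exact h5.sub_const p
  have hbound : ∀ t ∈ Set.Icc (0 : ℝ) 1,
      ‖fderiv ℂ g ((t : ℂ) • w) w‖ ≤ K * ‖g ((t : ℂ) • w) - p‖ + K := by
    intro t ht
    set w' := (t : ℂ) • w with hw'
    have hsub : Metric.ball w' (L - r) ⊆ Metric.ball (0 : CSpace d) L := by
      intro q hq
      rw [mem_ball_iff_norm] at hq
      rw [mem_ball_zero_iff]
      have h1 : ‖q‖ ≤ ‖q - w'‖ + ‖w'‖ := by simpa using norm_add_le (q - w') w'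
      linarith [hseg t ht]
    have hwL : ‖((L⁻¹ : ℝ) : ℂ) • w‖ ≤ 1 := by
      rw [norm_smul, Complex.norm_real, Real.norm_of_nonneg (by positivity), inv_mul_le_iff₀ hL]
      linarith
    -- The ball of radius L - r about w' yields a disc of radius (L - r)/6 times the norm of the
    -- derivative in the direction w/L. Undoing both scalings produces the factor 6L/(L - r) in K.
    have h1 := hdisc (g w') (((L - r) / 6 : ℝ) • fderiv ℂ g w' (((L⁻¹ : ℝ) : ℂ) • w)) (by
      intro ζ hζ
      have h2 : ‖ζ * (((L - r) / 6 : ℝ) : ℂ)‖ < (L - r) / 6 := by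
        rw [norm_mul, Complex.norm_real, Real.norm_of_nonneg (by positivity)]
        nlinarith
      have := hc.add_smul_fderiv_mem hC hLr (hg.mono hsub) (fun q hq => hgC (hsub hq)) hwL h2
      rwa [mul_smul, Complex.coe_smul] at this)
    rw [map_smul, norm_smul, norm_smul, Complex.norm_real, Real.norm_of_nonneg (by positivity),
      Real.norm_of_nonneg (by positivity)] at h1
    calc ‖fderiv ℂ g w' w‖
        = 6 * L / (L - r) * ((L - r) / 6 * (L⁻¹ * ‖fderiv ℂ g w' w‖)) := by field_simp
      _ ≤ 6 * L / (L - r) * (M * (1 + ‖g w' - p‖)) := by gcongr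
      _ = K * ‖g w' - p‖ + K := by rw [hK]; ring
  have := norm_le_gronwallBound_of_norm_deriv_right_le (f := fun t : ℝ => g ((t : ℂ) • w) - p)
    (f' := fun t => fderiv ℂ g ((t : ℂ) • w) w) (δ := 0) (K := K) (ε := K) (a := 0) (b := 1)
    (fun t ht => (hder t ht).continuousAt.continuousWithinAt)
    (fun t ht => (hder t ⟨ht.1, ht.2.le⟩).hasDerivWithinAt)
    (by simp [hg0]) (fun t ht => hbound t ⟨ht.1, ht.2.le⟩) 1 ⟨zero_le_one, le_rfl⟩
  simpa using this

/-- A holomorphic map into the closure of a convex open set that meets the set stays inside. -/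
theorem Convex.mapsTo_of_mapsTo_closure {C : Set (CSpace d)} (hC : IsOpen C) (hc : Convex ℝ C)
    {g : CSpace d → CSpace d} {U : Set (CSpace d)} (hU : IsOpen U) (hUc : IsPreconnected U)
    (hg : DifferentiableOn ℂ g U) (hgC : Set.MapsTo g U (closure C)) {a : CSpace d} (ha : a ∈ U)
    (hga : g a ∈ C) : Set.MapsTo g U C := by
  intro w hw
  by_contra hnot
  obtain ⟨ℓ, hℓ⟩ := RCLike.geometric_hahn_banach_open_point (𝕜 := ℂ) hc hC hnot
  have hle : ∀ y ∈ closure C, (ℓ y).re ≤ (ℓ (g w)).re := by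
    intro y hy
    have hcl : IsClosed {y | (ℓ y).re ≤ (ℓ (g w)).re} :=
      isClosed_le (by fun_prop) continuous_const
    exact hcl.closure_subset_iff.2 (fun y hy => (hℓ y hy).le) hy
  have hd : DifferentiableOn ℂ (fun z => Complex.exp (ℓ (g z))) U :=
    (ℓ.differentiable.comp_differentiableOn hg).cexp
  -- A supporting functional at g w makes |exp(ℓ ∘ g)| maximal at w, hence constant, although it is
  -- strictly smaller at a.
  have hmax : IsMaxOn (norm ∘ fun z => Complex.exp (ℓ (g z))) U w := by
    intro z hz
    simpa [Complex.norm_exp] using hle _ (hgC hz)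
  have := Complex.norm_eqOn_of_isPreconnected_of_isMaxOn hUc hU hd hw hmax ha
  simp only [Function.comp_apply, Function.const_apply, Complex.norm_exp, Real.exp_eq_exp] at this
  exact absurd (hℓ _ hga) (by simp [this])

end ConvexTarget

/-! ### Normal families and Hurwitz's theorem for injectivity -/

section NormalFamilies

variable {E F : Type*} [NormedAddCommGroup E] [NormedSpace ℂ E]
  [NormedAddCommGroup F] [NormedSpace ℂ F] {ι : Type*} {l : Filter ι}

/-- A family of maps that, locally on `Ω`, is eventually holomorphic and uniformly bounded. -/
def NormalAlong (l : Filter ι) (f : ι → E → F) (Ω : Set E) : Prop :=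
  ∀ z ∈ Ω, ∃ ρ > 0, Metric.ball z ρ ⊆ Ω ∧ ∃ M, ∀ᶠ i in l,
    DifferentiableOn ℂ (f i) (Metric.ball z ρ) ∧ ∀ w ∈ Metric.ball z ρ, ‖f i w‖ ≤ M

namespace NormalAlong

variable {f : ι → E → F} {f₀ : E → F} {Ω : Set E}

theorem isOpen (h : NormalAlong l f Ω) : IsOpen Ω :=
  Metric.isOpen_iff.2 fun z hz =>
    let ⟨ρ, hρ, hsub, _⟩ := h z hz
    ⟨ρ, hρ, hsub⟩

/-- Local bounds give equicontinuity by the Schwarz lemma, which upgrades pointwise to continuous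
convergence. -/
theorem tendsto_prod (h : NormalAlong l f Ω) {z : E} (hz : z ∈ Ω)
    (hlim : Tendsto (fun i => f i z) l (𝓝 (f₀ z))) :
    Tendsto (fun p : ι × E => f p.1 p.2) (l ×ˢ 𝓝 z) (𝓝 (f₀ z)) := by
  obtain ⟨ρ, hρ, -, M, hM⟩ := h z hz
  exact tendsto_prod_nhds_of_bounded hρ hM hlim

theorem tendsto_apply (h : NormalAlong l f Ω) {z : E} (hz : z ∈ Ω)
    (hlim : Tendsto (fun i => f i z) l (𝓝 (f₀ z))) {y : ι → E} (hy : Tendsto y l (𝓝 z)) :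
    Tendsto (fun i => f i (y i)) l (𝓝 (f₀ z)) :=
  (h.tendsto_prod hz hlim).comp (tendsto_id.prodMk hy)

theorem exists_limit [FiniteDimensional ℂ F] {u : Ultrafilter ι} (h : NormalAlong (u : Filter ι) f Ω) :
    ∃ f₀ : E → F, ∀ z ∈ Ω, Tendsto (fun i => f i z) u (𝓝 (f₀ z)) := by
  have : ProperSpace F := FiniteDimensional.proper ℂ F
  have : ∀ z, ∃ y, z ∈ Ω → Tendsto (fun i => f i z) u (𝓝 y) := by
    intro z
    by_cases hz : z ∈ Ω
    · obtain ⟨ρ, hρ, -, M, hM⟩ := h z hz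
      obtain ⟨y, -, hy⟩ := (isCompact_closedBall (0 : F) M).ultrafilter_le_nhds'
        (u.map fun i => f i z) (by
          have : ∀ᶠ i in (u : Filter ι), f i z ∈ Metric.closedBall 0 M :=
            hM.mono fun i hi => by simpa using hi.2 z (Metric.mem_ball_self hρ)
          exact this)
      exact ⟨y, fun _ => hy⟩
    · exact ⟨0, fun h => absurd h hz⟩
  choose f₀ hf₀ using this
  exact ⟨f₀, hf₀⟩

variable [FiniteDimensional ℂ E] [FiniteDimensional ℂ F]

theorem limit [l.NeBot] (h : NormalAlong l f Ω)
    (hlim : ∀ z ∈ Ω, Tendsto (fun i => f i z) l (𝓝 (f₀ z))) {z : E} (hz : z ∈ Ω) :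
    DifferentiableAt ℂ f₀ z ∧ Tendsto (fun i => fderiv ℂ (f i) z) l (𝓝 (fderiv ℂ f₀ z)) := by
  obtain ⟨ρ, hρ, hsub, M, hM⟩ := h z hz
  exact hasFDerivAt_limit hρ hM fun w hw => hlim w (hsub hw)

theorem differentiableOn_limit [l.NeBot] (h : NormalAlong l f Ω)
    (hlim : ∀ z ∈ Ω, Tendsto (fun i => f i z) l (𝓝 (f₀ z))) : DifferentiableOn ℂ f₀ Ω :=
  fun _ hz => (h.limit hlim hz).1.differentiableWithinAt

theorem fderiv (h : NormalAlong l f Ω) : NormalAlong l (fun i => fderiv ℂ (f i)) Ω := by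
  intro z hz
  obtain ⟨ρ, hρ, hsub, M, hM⟩ := h z hz
  have hball : ∀ w ∈ Metric.ball z (ρ / 2), Metric.ball w (ρ / 2) ⊆ Metric.ball z ρ := by
    intro w hw q hq
    rw [Metric.mem_ball] at *
    linarith [dist_triangle q w z]
  have hle : Metric.ball z (ρ / 2) ⊆ Metric.ball z ρ := Metric.ball_subset_ball (by linarith)
  refine ⟨ρ / 2, half_pos hρ, hle.trans hsub, 2 * M / (ρ / 2), hM.mono fun i hi => ⟨?_, ?_⟩⟩
  · exact (hi.1.differentiableOn_fderiv Metric.isOpen_ball).mono hle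
  · exact fun w hw => norm_fderiv_le_of_differentiableOn_ball (half_pos hρ)
      (hi.1.mono (hball w hw)) fun q hq => hi.2 q (hball w hw hq)

theorem tendsto_prod_fderiv [l.NeBot] (h : NormalAlong l f Ω)
    (hlim : ∀ z ∈ Ω, Tendsto (fun i => f i z) l (𝓝 (f₀ z))) {z : E} (hz : z ∈ Ω) :
    Tendsto (fun p : ι × E => _root_.fderiv ℂ (f p.1) p.2) (l ×ˢ 𝓝 z)
      (𝓝 (_root_.fderiv ℂ f₀ z)) :=
  h.fderiv.tendsto_prod (f₀ := _root_.fderiv ℂ f₀) hz (h.limit hlim hz).2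

/-- Values of the limit at a point where its derivative is invertible are eventually taken by the
family, near that point. -/
theorem eventually_mem_image [l.NeBot] [Nontrivial E] (h : NormalAlong l f Ω)
    (hlim : ∀ z ∈ Ω, Tendsto (fun i => f i z) l (𝓝 (f₀ z))) {z : E} (hz : z ∈ Ω)
    {A : E ≃L[ℂ] F} (hA : (A : E →L[ℂ] F) = _root_.fderiv ℂ f₀ z) {s : Set E} (hs : s ∈ 𝓝 z) :
    ∀ᶠ i in l, f₀ z ∈ f i '' s := by
  have : CompleteSpace E := FiniteDimensional.complete ℂ E
  let : NormedSpace ℝ E := NormedSpace.restrictScalars ℝ ℂ E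
  set N : NNReal := ‖(A.symm : F →L[ℂ] E)‖₊⁻¹ with hN
  have hN0 : 0 < N := inv_pos.2 A.nnnorm_symm_pos
  -- A map whose derivative stays within c < N of A on a ball of radius ε covers a ball of radius (N
  -- - c)ε/2 about f i z. Here ε is the same for all late i, so this ball eventually contains f₀ z.
  set c : NNReal := N / 2 with hc
  have hcN : (c : ℝ) = N / 2 := by simp [hc]
  have hN0' : (0 : ℝ) < N := hN0
  obtain ⟨ρ, hρ, -, M, hM⟩ := h z hz
  have h1 : ∀ᶠ p : ι × E in l ×ˢ 𝓝 z, ‖_root_.fderiv ℂ (f p.1) p.2 - A‖ < c := by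
    have := (h.tendsto_prod_fderiv hlim hz).sub_const (A : E →L[ℂ] F)
    rw [← hA, sub_self] at this
    have := this.norm
    rw [norm_zero] at this
    exact this.eventually_lt_const (by rw [hcN]; positivity)
  obtain ⟨p, hp, q, hq, hpq⟩ := eventually_prod_iff.1 h1
  obtain ⟨ε, hε, hball⟩ := Metric.mem_nhds_iff.1
    (inter_mem (inter_mem hq hs) (Metric.ball_mem_nhds z hρ))
  have hε2 : Metric.closedBall z (ε / 2) ⊆ Metric.ball z ε :=
    Metric.closedBall_subset_ball (by linarith)
  have h2 : ∀ᶠ i in l, dist (f₀ z) (f i z) < (N - c) * (ε / 2) := by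
    have := (hlim z hz).eventually (Metric.ball_mem_nhds (f₀ z) (ε := (N - c) * (ε / 2))
      (mul_pos (by rw [hcN]; linarith) (half_pos hε)))
    simpa [dist_comm] using this
  filter_upwards [hp, h2, hM] with i hi1 hi2 hi3
  have happ : ApproximatesLinearOn (f i) (A : E →L[ℂ] F) (Metric.ball z ε) c := by
    intro y hy y' hy'
    refine (convex_ball z ε).norm_image_sub_le_of_norm_hasFDerivWithin_le' (𝕜 := ℂ)
      (f' := _root_.fderiv ℂ (f i)) (fun w hw => ?_) (fun w hw => ?_) hy' hy
    · exact (hi3.1.differentiableAt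
        (Metric.isOpen_ball.mem_nhds (hball hw).2)).hasFDerivAt.hasFDerivWithinAt
    · exact (hpq hi1 (hball hw).1.1).le
  obtain ⟨y, hy, hfy⟩ := happ.surjOn_closedBall_of_nonlinearRightInverse
    A.toNonlinearRightInverse (half_pos hε).le hε2 (show f₀ z ∈ _ from by
      rw [Metric.mem_closedBall]
      refine hi2.le.trans_eq ?_
      simp [hN, ContinuousLinearEquiv.toNonlinearRightInverse])
  exact ⟨y, (hball (hε2 hy)).1.2, hfy⟩

/-- The theorem of Hurwitz for injectivity: the limit of injective holomorphic maps on a convex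
set is injective if its derivative is somewhere invertible. -/
theorem injOn_limit {E F : Type} [NormedAddCommGroup E] [NormedSpace ℂ E]
    [NormedAddCommGroup F] [NormedSpace ℂ F] [FiniteDimensional ℂ E] [FiniteDimensional ℂ F]
    [Nontrivial E] [NormedSpace ℝ E] [IsScalarTower ℝ ℂ E] [l.NeBot]
    (hEF : Module.finrank ℂ E = Module.finrank ℂ F) {f : ι → E → F} {f₀ : E → F} {Ω : Set E}
    (hΩ : Convex ℝ Ω) (h : NormalAlong l f Ω)
    (hlim : ∀ z ∈ Ω, Tendsto (fun i => f i z) l (𝓝 (f₀ z)))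
    (hinj : ∀ z ∈ Ω, ∀ w ∈ Ω, ∃ s ∈ 𝓝 z, ∃ t ∈ 𝓝 w, ∀ᶠ i in l, Set.InjOn (f i) (s ∪ t))
    {x : E} (hx : x ∈ Ω) (hfx : Function.Injective (_root_.fderiv ℂ f₀ x)) : Set.InjOn f₀ Ω := by
  let e : F ≃L[ℂ] E := ContinuousLinearEquiv.ofFinrankEq hEF.symm
  let J : (E →L[ℂ] F) → ℂ := fun A =>
    LinearMap.det (((e : F →L[ℂ] E) ∘L A : E →L[ℂ] E) : E →ₗ[ℂ] E)
  have hJd : Differentiable ℂ J := by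
    have h1 : Differentiable ℂ fun A : E →L[ℂ] F => (e : F →L[ℂ] E) ∘L A :=
      (differentiable_const _).clm_comp differentiable_id
    exact Differentiable.comp (g := fun A : E →L[ℂ] E => LinearMap.det (A : E →ₗ[ℂ] E))
      ContinuousLinearMap.differentiable_det h1
  have hJ : ∀ A, J A ≠ 0 ↔ Function.Injective A := fun A =>
    (ContinuousLinearMap.det_ne_zero_iff_injective _).trans
      ⟨fun hA => Function.Injective.of_comp (f := e) hA, fun hA => e.injective.comp hA⟩
  have hopen := h.isOpen
  have hf₀ := h.differentiableOn_limit hlim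
  -- On the complex line through b and x the Jacobian of f₀ is nonzero at x, so a zero at b is
  -- isolated. Hurwitz then gives a zero of the Jacobian of some injective f i near b, against
  -- Osgood.
  have hnd : ∀ b ∈ Ω, J (_root_.fderiv ℂ f₀ b) ≠ 0 := by
    intro b hb hJb
    let γ : ℂ → E := fun s => b + s • (x - b)
    have hγc : Continuous γ := by fun_prop
    have hγ0 : γ 0 = b := by simp [γ]
    let V : Set ℂ := γ ⁻¹' Ω
    have hV : IsOpen V := hopen.preimage hγc
    have hVc : Convex ℝ V := by
      intro s hs t ht a c ha hc hac
      have := hΩ hs ht ha hc hac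
      change γ (a • s + c • t) ∈ Ω
      convert! this using 1
      have hb' : b = a • b + c • b := by rw [← add_smul, hac, one_smul]
      simp only [γ]
      rw [smul_add, smul_add, add_smul, smul_assoc, smul_assoc]
      nth_rewrite 1 [hb']
      abel
    have h0V : (0 : ℂ) ∈ V := by simpa [V, hγ0] using hb
    have h1V : (1 : ℂ) ∈ V := by simpa [V, γ] using hx
    let φ : ℂ → ℂ := fun s => J (_root_.fderiv ℂ f₀ (γ s))
    have hφd : DifferentiableOn ℂ φ V :=
      hJd.comp_differentiableOn ((hf₀.differentiableOn_fderiv hopen).comp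
        (by fun_prop) fun s hs => hs)
    have hφan : AnalyticOnNhd ℂ φ V := hφd.analyticOnNhd hV
    have hφ0 : φ 0 = 0 := by simpa [φ, hγ0] using hJb
    have hisol : ∀ᶠ s in 𝓝[≠] (0 : ℂ), φ s ≠ 0 := by
      refine (hφan 0 h0V).eventually_eq_zero_or_eventually_ne_zero.resolve_left fun hev => ?_
      have := hφan.eqOn_zero_of_preconnected_of_eventuallyEq_zero hVc.isPreconnected h0V hev h1V
      refine (hJ _).2 hfx ?_
      simpa [φ, γ] using this
    obtain ⟨ρ, hρ, hρΩ, M, hM⟩ := h b hb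
    obtain ⟨s, hs, _, _, hsinj⟩ := hinj b hb b hb
    obtain ⟨ρ', hρ', hball'⟩ := Metric.mem_nhds_iff.1
      (inter_mem (interior_mem_nhds.2 hs) (Metric.ball_mem_nhds b hρ))
    have hev : ∀ᶠ s in 𝓝 (0 : ℂ), γ s ∈ Metric.ball b ρ' :=
      hγc.continuousAt.eventually_mem (by rw [hγ0]; exact Metric.ball_mem_nhds b hρ')
    obtain ⟨r, hr, hrball⟩ := Metric.nhds_basis_closedBall.mem_iff.1
      (hev.and (eventually_nhdsWithin_iff.1 hisol))
    have hB : ∀ t ∈ Metric.closedBall (0 : ℂ) r, γ t ∈ Metric.ball b ρ' := fun t ht =>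
      (hrball ht).1
    have hBΩ : ∀ t ∈ Metric.closedBall (0 : ℂ) r, γ t ∈ Ω := fun t ht =>
      hρΩ (hball' (hB t ht)).2
    have hsphere : Metric.sphere (0 : ℂ) r ⊆ Metric.closedBall 0 r :=
      Metric.sphere_subset_closedBall
    have hjoint : ∀ t ∈ Metric.closedBall (0 : ℂ) r,
        Tendsto (fun p : ι × ℂ => J (_root_.fderiv ℂ (f p.1) (γ p.2))) (l ×ˢ 𝓝 t) (𝓝 (φ t)) := by
      intro t ht
      have h1 := h.tendsto_prod_fderiv hlim (hBΩ t ht)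
      have h2 : Tendsto (fun p : ι × ℂ => (p.1, γ p.2)) (l ×ˢ 𝓝 t) (l ×ˢ 𝓝 (γ t)) :=
        tendsto_fst.prodMk ((hγc.tendsto t).comp tendsto_snd)
      exact (hJd.continuous.tendsto _).comp (h1.comp h2)
    have hzero := eventually_exists_zero (l := l)
      (Φ := fun i t => J (_root_.fderiv ℂ (f i) (γ t))) (φ := φ) hr
      (hM.mono fun i hi => by
        refine DifferentiableOn.diffContOnCl ?_
        rw [closure_ball _ hr.ne']
        exact hJd.comp_differentiableOn ((hi.1.differentiableOn_fderiv Metric.isOpen_ball).comp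
          (by fun_prop) fun t ht => (hball' (hB t ht)).2))
      (fun t ht => (hφd.differentiableAt (hV.mem_nhds
        (hBΩ t (hsphere ht)))).continuousAt.continuousWithinAt)
      (fun t ht => hjoint t (hsphere ht))
      (by
        have h1 := (hjoint 0 (by simp [hr.le])).comp
          (f := fun i : ι => (i, (0 : ℂ))) (x := l) (tendsto_id.prodMk tendsto_const_nhds)
        rw [hφ0] at h1
        exact h1)
      (fun t ht => (hrball (hsphere ht)).2 (by
        rintro rfl
        simp [hr.ne] at ht))
    obtain ⟨i, ⟨t, ht, hti⟩, hi, hiM⟩ := (hzero.and (hsinj.and hM)).exists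
    refine (hJ _).2 ?_ hti
    refine injective_fderiv_of_injOn hEF (U := interior s ∩ Metric.ball b ρ)
      (isOpen_interior.inter Metric.isOpen_ball)
      (hiM.1.mono Set.inter_subset_right)
      (hi.mono ((Set.inter_subset_left.trans interior_subset).trans Set.subset_union_left)) (hball' (hB t ht))
  intro a ha b hb hab
  by_contra hne
  obtain ⟨s, hs, t, ht, hst⟩ := hinj a ha b hb
  obtain ⟨s', hs', t', ht', hd⟩ := Filter.disjoint_iff.1 (disjoint_nhds_nhds.2 hne)
  have : CompleteSpace E := FiniteDimensional.complete ℂ E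
  let A : ∀ z ∈ Ω, E ≃L[ℂ] F := fun z hz =>
    ContinuousLinearEquiv.ofBijective (_root_.fderiv ℂ f₀ z)
      (LinearMap.ker_eq_bot.2 ((hJ _).1 (hnd z hz)))
      (LinearMap.range_eq_top.2 ((LinearMap.injective_iff_surjective_of_finrank_eq_finrank hEF).1
        ((hJ _).1 (hnd z hz))))
  -- The common value f₀ a = f₀ b is eventually taken by f i near a and near b, on disjoint
  -- neighbourhoods.
  have h1 := h.eventually_mem_image hlim ha (A := A a ha) rfl (inter_mem hs hs')
  have h2 := h.eventually_mem_image hlim hb (A := A b hb) rfl (inter_mem ht ht')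
  obtain ⟨i, ⟨p, hp, hpa⟩, ⟨q, hq, hqb⟩, hi⟩ := (h1.and (h2.and hst)).exists
  have hpq : p = q := hi (Or.inl hp.1) (Or.inr hq.1) (by rw [hpa, hqb, hab])
  exact Set.disjoint_left.1 hd hp.2 (hpq ▸ hq.2)

end NormalAlong

end NormalFamilies

/-! ### Passage to the limit in the squeezing function -/

theorem CSpace.nontrivial {d : ℕ} (hd : 0 < d) : Nontrivial (CSpace d) :=
  ⟨EuclideanSpace.single ⟨0, hd⟩ 1, 0, by simp⟩

theorem squeezingSet_of_le {d : ℕ} {Ω : Set (CSpace d)} {p : CSpace d} {r s : ℝ}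
    (hr : r ∈ squeezingSet Ω p) (hs : 0 < s) (hsr : s ≤ r) : s ∈ squeezingSet Ω p := by
  obtain ⟨-, f, h1, h2, h3, h4, h5⟩ := hr
  exact ⟨hs, f, h1, h2, h3, h4, (Metric.ball_subset_ball hsr).trans h5⟩

theorem mem_squeezingSet_of_lt_squeezing {d : ℕ} {Ω : Set (CSpace d)} {p : CSpace d} {r : ℝ}
    (h0 : 0 < r) (hr : r < squeezing Ω p) : r ∈ squeezingSet Ω p := by
  have hne : (squeezingSet Ω p).Nonempty := by
    by_contra hne
    rw [squeezing, Set.not_nonempty_iff_eq_empty.1 hne, Real.sSup_empty] at hr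
    exact lt_asymm h0 hr
  obtain ⟨s, hs, hrs⟩ := exists_lt_of_lt_csSup hne hr
  exact squeezingSet_of_le hs h0 hrs.le

/-- Radii realized by the approximating domains are realized by the limit domain. -/
theorem PointedConvexDomain.Converges.mem_squeezingSet {d : ℕ} (hd : 0 < d)
    {P : ℕ → PointedConvexDomain d} {Q : PointedConvexDomain d}
    (hPQ : PointedConvexDomain.Converges P Q) {u : Ultrafilter ℕ} (hu : (u : Filter ℕ) ≤ atTop)
    {L : ℝ} (hL : 0 < L)
    (hmem : ∀ᶠ n in (u : Filter ℕ), L ∈ squeezingSet (P n).domain.carrier (P n).point) :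
    L ∈ squeezingSet Q.domain.carrier Q.point := by
  have := CSpace.nontrivial hd
  obtain ⟨hconv, hpt⟩ := hPQ
  set x := Q.point with hx
  set Ω := Q.domain.carrier with hΩdef
  have hΩ : IsOpen Ω := Q.domain.isOpen
  have hΩc : Convex ℝ Ω := Q.domain.convex
  have hxΩ : x ∈ Ω := Q.point_mem
  let A : ℕ → Set (CSpace d) := fun n => (P n).domain.carrier
  let y : ℕ → CSpace d := fun n => (P n).point
  have hA : ∀ n, IsOpen (A n) := fun n => (P n).domain.isOpen
  have hAc : ∀ n, Convex ℝ (A n) := fun n => (P n).domain.convex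
  have hyA : ∀ n, y n ∈ A n := fun n => (P n).point_mem
  have hyx : Tendsto y u (𝓝 x) := hpt.mono_left hu
  -- The default `id` is harmless: it is chosen only for n outside a set of the ultrafilter.
  have hf : ∀ n, ∃ f : CSpace d → CSpace d, L ∈ squeezingSet (A n) (y n) →
      DifferentiableOn ℂ f (A n) ∧ Set.InjOn f (A n) ∧ Set.MapsTo f (A n) (Metric.ball 0 1) ∧
        f (y n) = 0 ∧ Metric.ball 0 L ⊆ f '' A n := by
    intro n
    by_cases h : L ∈ squeezingSet (A n) (y n)
    · exact ⟨h.2.choose, fun _ => h.2.choose_spec⟩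
    · exact ⟨id, fun h' => absurd h' h⟩
  choose f hf using hf
  have hfu : ∀ᶠ n in (u : Filter ℕ), DifferentiableOn ℂ (f n) (A n) ∧ Set.InjOn (f n) (A n) ∧
      Set.MapsTo (f n) (A n) (Metric.ball 0 1) ∧ f n (y n) = 0 ∧ Metric.ball 0 L ⊆ f n '' A n :=
    hmem.mono hf
  have hball : ∀ z ∈ Ω, ∃ ρ > 0, ∀ᶠ n in (u : Filter ℕ), Metric.ball z ρ ⊆ A n := by
    intro z hz
    obtain ⟨ρ, hρ, h⟩ := LocalHausdorffConverges.eventually_ball_subset hconv hA hAc hΩ hz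
    exact ⟨ρ, hρ, h.filter_mono hu⟩
  -- the limit of the maps
  have hfN : NormalAlong (u : Filter ℕ) f Ω := by
    intro z hz
    obtain ⟨ρ, hρ, h⟩ := hball z hz
    obtain ⟨ρ', hρ', h'⟩ := Metric.isOpen_iff.1 hΩ z hz
    refine ⟨min ρ ρ', lt_min hρ hρ', (Metric.ball_subset_ball (min_le_right _ _)).trans h', 1, ?_⟩
    filter_upwards [h, hfu] with n hn hfn
    have hsub := (Metric.ball_subset_ball (min_le_left ρ ρ')).trans hn
    exact ⟨hfn.1.mono hsub, fun w hw => (mem_ball_zero_iff.1 (hfn.2.2.1 (hsub hw))).le⟩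
  obtain ⟨F, hF⟩ := hfN.exists_limit
  have hFd : DifferentiableOn ℂ F Ω := hfN.differentiableOn_limit hF
  have hFx : F x = 0 := by
    refine tendsto_nhds_unique (hfN.tendsto_apply hxΩ (hF x hxΩ) hyx) ?_
    exact tendsto_const_nhds.congr' (hfu.mono fun n hn => hn.2.2.2.1.symm)
  have hF1 : ∀ z ∈ Ω, ‖F z‖ ≤ 1 := by
    intro z hz
    refine le_of_tendsto (hF z hz).norm ?_
    obtain ⟨ρ, hρ, h⟩ := hball z hz
    filter_upwards [h, hfu] with n hn hfn
    exact (mem_ball_zero_iff.1 (hfn.2.2.1 (hn (Metric.mem_ball_self hρ)))).le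
  have hFmaps : Set.MapsTo F Ω (Metric.ball 0 1) := by
    intro z hz
    rw [mem_ball_zero_iff]
    -- If ‖F z‖ were 1, the maximum principle would make the norm constant, against F x = 0.
    refine lt_of_le_of_ne (hF1 z hz) fun heq => ?_
    have hmax : IsMaxOn (norm ∘ F) Ω z := fun w hw => by
      simpa [heq] using hF1 w hw
    have := Complex.norm_eqOn_of_isPreconnected_of_isMaxOn hΩc.isPreconnected hΩ hFd hz hmax hxΩ
    simp [hFx, heq] at this
  -- the limit of the inverses
  let g : ℕ → CSpace d → CSpace d := fun n => Function.invFunOn (f n) (A n)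
  have hgu : ∀ᶠ n in (u : Filter ℕ), DifferentiableOn ℂ (g n) (Metric.ball 0 L) ∧
      Set.MapsTo (g n) (Metric.ball 0 L) (A n) ∧ (∀ w ∈ Metric.ball 0 L, f n (g n w) = w) ∧
      g n 0 = y n := by
    filter_upwards [hfu] with n hn
    obtain ⟨h1, h2, -, h4, h5⟩ := hn
    refine ⟨fun w hw => ?_, fun w hw => Function.invFunOn_mem (h5 hw),
      fun w hw => Function.invFunOn_eq (h5 hw), ?_⟩
    · obtain ⟨z, hz, rfl⟩ := h5 hw
      exact (differentiableAt_invFunOn rfl (hA n) h1 h2 hz).differentiableWithinAt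
    · rw [← h4]
      exact h2.leftInvOn_invFunOn (hyA n)
  obtain ⟨M, hM, hdisc⟩ := LocalHausdorffConverges.exists_affine_disc_bound hconv hAc hΩ hΩc
    Q.domain.no_complex_line hyA hxΩ hpt
  have hgN : NormalAlong (u : Filter ℕ) g (Metric.ball 0 L) := by
    intro w hw
    rw [mem_ball_zero_iff] at hw
    set r := (‖w‖ + L) / 2 with hr
    have hrL : r < L := by rw [hr]; linarith
    have hsub : ∀ z ∈ Metric.ball w (r - ‖w‖), ‖z‖ ≤ r := by
      intro z hz
      rw [mem_ball_iff_norm] at hz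
      have : ‖z‖ ≤ ‖z - w‖ + ‖w‖ := by simpa using norm_add_le (z - w) w
      linarith
    have hsub' : Metric.ball w (r - ‖w‖) ⊆ Metric.ball 0 L := fun z hz =>
      mem_ball_zero_iff.2 ((hsub z hz).trans_lt hrL)
    set B := gronwallBound 0 (6 * L * M / (L - r)) (6 * L * M / (L - r)) 1 with hB
    refine ⟨r - ‖w‖, by rw [hr]; linarith, hsub', B + (‖x‖ + 1), ?_⟩
    filter_upwards [hgu, hdisc.filter_mono hu, hyx.norm.eventually_lt_const (lt_add_one _)]
      with n hn1 hn2 hn3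
    refine ⟨hn1.1.mono hsub', fun z hz => ?_⟩
    have h1 := (hAc n).norm_sub_le_gronwallBound (hA n) hn2 hL hrL hn1.1 hn1.2.1 hn1.2.2.2
      (hsub z hz)
    have h2 : ‖g n z‖ ≤ ‖g n z - y n‖ + ‖y n‖ := by simpa using norm_add_le (g n z - y n) (y n)
    linarith
  obtain ⟨G, hG⟩ := hgN.exists_limit
  have hGd : DifferentiableOn ℂ G (Metric.ball 0 L) := hgN.differentiableOn_limit hG
  have h0L : (0 : CSpace d) ∈ Metric.ball (0 : CSpace d) L := Metric.mem_ball_self hL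
  have hG0 : G 0 = x := by
    refine tendsto_nhds_unique (hG 0 h0L) (hyx.congr' ?_)
    exact hgu.mono fun n hn => hn.2.2.2.symm
  have hGcl : Set.MapsTo G (Metric.ball 0 L) (closure Ω) := fun w hw =>
    LocalHausdorffConverges.mem_closure_of_tendsto hconv (φ := id) hu
      (hgu.mono fun n hn => hn.2.1 hw) (hG w hw)
  have hGΩ : Set.MapsTo G (Metric.ball 0 L) Ω :=
    hΩc.mapsTo_of_mapsTo_closure hΩ Metric.isOpen_ball (convex_ball _ _).isPreconnected hGd hGcl
      h0L (hG0 ▸ hxΩ)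
  have hFG : ∀ w ∈ Metric.ball 0 L, F (G w) = w := by
    intro w hw
    refine tendsto_nhds_unique (hfN.tendsto_apply (hGΩ hw) (hF _ (hGΩ hw)) (hG w hw)) ?_
    exact tendsto_const_nhds.congr' (hgu.mono fun n hn => (hn.2.2.1 w hw).symm)
  -- injectivity of the limit
  have hFx' : Function.Injective (fderiv ℂ F x) := by
    have h1 : HasFDerivAt F (fderiv ℂ F x) (G 0) := by
      rw [hG0]
      exact (hFd.differentiableAt (hΩ.mem_nhds hxΩ)).hasFDerivAt
    have h2 := h1.comp 0 (hGd.differentiableAt (Metric.isOpen_ball.mem_nhds h0L)).hasFDerivAt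
    have h3 : HasFDerivAt (F ∘ G) (ContinuousLinearMap.id ℂ (CSpace d)) 0 := by
      refine (hasFDerivAt_id _).congr_of_eventuallyEq ?_
      filter_upwards [Metric.isOpen_ball.mem_nhds h0L] with w hw using hFG w hw
    have h4 := h2.unique h3
    have hsurj : Function.Surjective (fderiv ℂ F x) := fun v =>
      ⟨fderiv ℂ G 0 v, by simpa using congrArg (fun T : CSpace d →L[ℂ] CSpace d => T v) h4⟩
    exact (LinearMap.injective_iff_surjective (f := (fderiv ℂ F x : CSpace d →ₗ[ℂ] CSpace d))).2
      hsurj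
  -- Injectivity is only available on pairs of small balls, because no A n need contain all of Ω.
  have hinj : ∀ z ∈ Ω, ∀ w ∈ Ω, ∃ s ∈ 𝓝 z, ∃ t ∈ 𝓝 w,
      ∀ᶠ n in (u : Filter ℕ), Set.InjOn (f n) (s ∪ t) := by
    intro z hz w hw
    obtain ⟨ρ, hρ, h⟩ := hball z hz
    obtain ⟨ρ', hρ', h'⟩ := hball w hw
    refine ⟨_, Metric.ball_mem_nhds z hρ, _, Metric.ball_mem_nhds w hρ', ?_⟩
    filter_upwards [h, h', hfu] with n hn hn' hfn
    exact hfn.2.1.mono (Set.union_subset hn hn')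
  exact ⟨hL, F, hFd, hfN.injOn_limit rfl hΩc hF hinj hxΩ hFx', hFmaps, hFx,
    fun w hw => ⟨G w, hGΩ hw, hFG w hw⟩⟩

theorem PointedConvexDomain.limsup_squeezing_le {d : ℕ} (hd : 0 < d)
    {P : ℕ → PointedConvexDomain d} {Q : PointedConvexDomain d}
    (hPQ : PointedConvexDomain.Converges P Q) :
    limsup (fun n => (P n).squeezing) atTop ≤ Q.squeezing := by
  by_contra! hlt
  obtain ⟨L, hQL, hL⟩ := exists_between hlt
  have hL0 : 0 < L := (squeezing_nonneg _ _).trans_lt hQL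
  have hfreq : ∃ᶠ n in atTop, L < (P n).squeezing :=
    frequently_lt_of_lt_limsup
      (isCoboundedUnder_le_of_le atTop (x := 0) fun n => squeezing_nonneg _ _) hL
  have hne : (atTop ⊓ 𝓟 {n | L < (P n).squeezing}).NeBot := frequently_mem_iff_neBot.1 hfreq
  -- An ultrafilter finer than `atTop` containing the infinite set where L is exceeded plays the
  -- role of a convergent subsequence.
  set u := Ultrafilter.of (atTop ⊓ 𝓟 {n | L < (P n).squeezing}) with hu
  have hule : (u : Filter ℕ) ≤ atTop ⊓ 𝓟 {n | L < (P n).squeezing} := Ultrafilter.of_le _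
  have hmem := hPQ.mem_squeezingSet hd (hule.trans inf_le_left) hL0
    (mem_of_superset (hule.trans inf_le_right (mem_principal_self _))
      fun _ hn => mem_squeezingSet_of_lt_squeezing hL0 hn)
  exact absurd (le_csSup ⟨1, fun r hr => squeezingSet_le_one hd hr⟩ hmem) (not_le.2 hQL)

theorem proposition7p1 (d : ℕ) (hd : 0 < d) :
    (∀ (P : ℕ → PointedConvexDomain d) (Q : PointedConvexDomain d),
      PointedConvexDomain.Converges P Q →
        limsup (fun n => (P n).squeezing) atTop ≤ Q.squeezing) ∧
      UpperSemicontinuous (fun Q : PointedConvexDomain d => Q.squeezing) := by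
  refine ⟨fun P Q hPQ => PointedConvexDomain.limsup_squeezing_le hd hPQ, ?_⟩
  intro Q c hc
  -- Openness is by definition a statement about convergent sequences, so the limsup inequality
  -- gives it directly; the bound by 1 is needed because the real `limsup` is meaningful only for
  -- bounded sequences.
  have hopen : IsOpen {P : PointedConvexDomain d | P.squeezing < c} := by
    intro Q' hQ' P hP
    exact eventually_lt_of_limsup_lt
      ((PointedConvexDomain.limsup_squeezing_le hd hP).trans_lt hQ')
      (isBoundedUnder_of ⟨1, fun n => squeezing_le_one hd _ _⟩)
  exact hopen.mem_nhds hc
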